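/- **Setting.** Let $\mu$ be a measure on $\mathbb R$, and let $b,k:\mathbb R\to\mathbb R$ be such that $y\mapsto \exp\{y\eta-b(\eta)+k(y)\}$ is a probability density with respect to $\mu$ for every $\eta\in\mathbb R$. Assume that $b$ is strictly convex and three times differentiable, and that $\sup_{|y|\le 1/2}b''(x+y)\le C_{\rm dev}\,b''(x)$ for all $x\in\mathbb R$ and some constant $C_{\rm dev}\ge 1$. For each $n\ge n_0$ let $\mathbf X\in\mathbb R^{n\times p}$ ($p=p_n$) be a non-random matrix with rows $x_i^\top$, and let $\theta_0\in\mathbb R^p$ be non-zero. Under the true law $\mathbb P_0^{(n)}$ the observations $Y_1,\dots,Y_n$ are independent, $Y_i$ having density $p_{\theta_0}(y\mid x_i)=\exp\{y\,x_i^\top\theta_0-b(x_i^\top\theta_0)+k(y)\}$; $\mathbb E$ is the expectation under $\mathbb P_0^{(n)}$. Assume $p\ge n^{C}$ for some constant $C>0$. For $\theta\in\mathbb R^p$ let $S_\theta=\{j:\theta_j\ne0\}$; put $S_0=S_{\theta_0}$ and $s_0=|S_0|\geq 1$. For $S\subseteq\{1,\dots,p\}$ let $\mathbf X_S$ be the submatrix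 of the columns in $S$, with rows $x_{i,S}^\top$. Let $L_{n,\theta}=\sum_i\{Y_ix_i^\top\theta-b(x_i^\top\theta)+k(Y_i)\}$, let $L_{n,\theta_S}$ be the same with $x_{i,S},\theta_S$ in place of $x_i,\theta$, and let $$\widehat\theta_S=\operatorname*{argmax}_{\theta_S\in\mathbb R^{|S|}}L_{n,\theta_S},\qquad \theta^*_S=\operatorname*{argmax}_{\theta_S\in\mathbb R^{|S|}}\mathbb E L_{n,\theta_S},\qquad \mathbf F_{n,\theta_S}=\sum_{i}b''(x_{i,S}^\top\theta_S)\,x_{i,S}x_{i,S}^\top$$ (with $\widehat\theta_S=0$ by convention at observations where no maximizer exists; $\mathbb E L_{n,\theta_S}$ is understood up to the term $\mathbb E\sum_i k(Y_i)$, which does not involve $\theta_S$). Let $\rho_{\min,S},\rho_{\max,S}$ be the smallest and largest eigenvalues of $\mathbf F_{n,\theta_S^*}$, let $\zeta_{n,S}=\max_i\|\mathbf F_{n,\theta^*_S}^{-1/2}x_{i,S}\|_2$, and let $\|\mathbf A\|_\infty=\max_i\sum_j|a_{ij}|$. **Prior and posterior.** Let $s_0\le s_{\max}\le\operatorname{rank}(\mathbf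 X)$, and let $w_n$ be a probability mass function on $\{0,\dots,s_{\max}\}$ such that, with constants $A_1,A_2,A_3,A_4>0$, $$A_1p^{-A_3}w_n(s-1)\le w_n(s)\le A_2p^{-A_4}w_n(s-1),\qquad 1\le s\le s_{\max}.$$ With $\lambda=\lambda_n$ and $g_S$ the density of $\mathcal N_{|S|}\bigl(\widehat\theta_S,\{\lambda\mathbf F_{n,\widehat\theta_S}\}^{-1}\bigr)$, the prior is $\Pi_n(\mathrm d\theta)=\sum_S w_n(|S|)\binom p{|S|}^{-1}g_S(\theta_S)\,\mathrm d\theta_S\times\delta_0(\mathrm d\theta_{S^c})$, and the $\alpha$-fractional posterior is $\Pi^n_\alpha(\mathcal A)=\int_{\mathcal A}e^{\alpha L_{n,\theta}}\,\Pi_n(\mathrm d\theta)\big/\int e^{\alpha L_{n,\theta}}\,\Pi_n(\mathrm d\theta)$. **(A1)** There are non-random $D_n>\sqrt2$ and $\overline\theta_S\in\mathbb R^{|S|}$ such that $\mathbf F_{n,\overline\theta_S}$ is nonsingular for all $|S|\le s_{\max}$ and, with $\mathbb P_0^{(n)}$-probability at least $1-p^{-1}$, for all $S$ with $|S|\le s_{\max}$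 the maximizer $\widehat\theta_S$ exists, $$D_n^{-1}\mathbf F_{n,\overline\theta_S}\preceq\mathbf F_{n,\widehat\theta_S}\preceq D_n\mathbf F_{n,\overline\theta_S}\quad\text{and}\quad \bigl\|\mathbf F_{n,\overline\theta_S}^{1/2}(\widehat\theta_S-\overline\theta_S)\bigr\|_2^2\le D_n|S|\log p .$$ Moreover $\mathbf F_{n,\theta^*_{S_0}}$ is nonsingular and $\zeta_{n,S_0}^2\,s_0\log p=o(1)$. **(A2)** $\log\bigl(\max_i b''(x_i^\top\theta_0)\vee\|\mathbf X_{S_0}\|_\infty\vee\rho_{\min,S_0}^{-1}\vee\rho_{\max,S_0}\bigr)=O(\log p)$ and $s_0\log p=o(n)$; there are constants $A_5,A_6>0$ and $A_7\ge0$ with $p^{-A_5}\le\lambda\le A_6p^{-A_7}$; $\alpha\in(0,1)$ is a constant, $A_6p^{-A_7}<A_4$, and $\log_p(D_n)=o(1)$. (All asymptotic relations are as $n\to\infty$.) **Theorem.** Under the above setting, (A1) and (A2), there is a constant $K_{\rm dim}>1$, not depending on $n$, such that for all $n\geq n_0$ $$\mathbb E\,\Pi_\alpha^n\bigl\{\theta:|S_\theta|>K_{\rm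 dim}\,s_0\bigr\}\le (s_0\log p)^{-1}+2p^{-1}+p^{-s_0}.$$ (The posterior probability on the left is a measurable function of the data. If $p=1$, the first term on the right is read as $0$.) -/

import Mathlib

open MeasureTheory Filter Topology Asymptotics
open scoped ENNReal Matrix

noncomputable section

/-- A one-parameter exponential family `p_η(y) = exp {y η - b η + k y}` of probability densities
with respect to a dominating measure `μ` on `ℝ`, indexed by every natural parameter `η : ℝ`,
together with the standing regularity of the cumulant function `b`. -/
structure ExpFamily where
  μ : Measure ℝ
  k : ℝ → ℝ
  b : ℝ → ℝ
  measurable_k : Measurable k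
  /-- every `p_η` is a probability density -/
  lintegral_density : ∀ η : ℝ, ∫⁻ y, ENNReal.ofReal (Real.exp (y * η - b η + k y)) ∂μ = 1
  strictConvexOn_b : StrictConvexOn ℝ Set.univ b
  /-- `b` is three times differentiable -/
  differentiable_b : Differentiable ℝ b
  differentiable_deriv_b : Differentiable ℝ (deriv b)
  differentiable_deriv2_b : Differentiable ℝ (deriv (deriv b))
  /-- local control of the variance function: `sup_{|y| ≤ 1/2} b''(x + y) ≤ C_dev b''(x)` -/
  exists_Cdev : ∃ Cdev : ℝ, 1 ≤ Cdev ∧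
    ∀ x y : ℝ, |y| ≤ 1 / 2 → deriv (deriv b) (x + y) ≤ Cdev * deriv (deriv b) x

namespace GLM

variable {n p : ℕ} {ι : Type*}

/-- The law on `ℝ` with density `p_η` with respect to `μ`. -/
def law (M : ExpFamily) (η : ℝ) : Measure ℝ :=
  M.μ.withDensity fun y => ENNReal.ofReal (Real.exp (y * η - M.b η + M.k y))

/-- The joint law `P_θ^{(n)}` of `Y = (Y_1, …, Y_n)`: independent coordinates, `Y_i` having the
density `p_θ(· | x_i)`, where `x_i` is the `i`-th row of `X`. -/
def jointLaw (M : ExpFamily) (X : Matrix (Fin n) (Fin p) ℝ) (θ : Fin p → ℝ) :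
    Measure (Fin n → ℝ) :=
  Measure.pi fun i => law M ((X *ᵥ θ) i)

/-- The support `S_θ` of a coefficient vector. -/
def supp (θ : Fin p → ℝ) : Finset (Fin p) := Finset.univ.filter fun j => θ j ≠ 0

/-- The submatrix `X_S` of the columns of `X` with index in `S`. -/
def cols (X : Matrix (Fin n) (Fin p) ℝ) (S : Finset (Fin p)) : Matrix (Fin n) S ℝ :=
  X.submatrix id Subtype.val

/-- The `p`-vector version of `θ_S`, with zeros outside of `S`. -/
def extend (S : Finset (Fin p)) (θ : S → ℝ) : Fin p → ℝ :=
  fun j => if h : j ∈ S then θ ⟨j, h⟩ else 0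

/-- The log-likelihood with design matrix `Z`. For `Z = X` this is `L_{n,θ}`, for `Z = X_S` it is
`L_{n,θ_S}`. -/
def logLik [Fintype ι] (M : ExpFamily) (Z : Matrix (Fin n) ι ℝ) (y : Fin n → ℝ) (θ : ι → ℝ) : ℝ :=
  ∑ i, (y i * (Z *ᵥ θ) i - M.b ((Z *ᵥ θ) i) + M.k (y i))

/-- `θ` maximizes the log-likelihood with design matrix `Z` at the observation `y`. -/
def IsMLE [Fintype ι] (M : ExpFamily) (Z : Matrix (Fin n) ι ℝ) (y : Fin n → ℝ) (θ : ι → ℝ) : Prop :=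
  ∀ θ' : ι → ℝ, logLik M Z y θ' ≤ logLik M Z y θ

open Classical in
/-- The maximum likelihood estimator; the zero vector at observations where no maximizer exists. -/
def mle [Fintype ι] (M : ExpFamily) (Z : Matrix (Fin n) ι ℝ) (y : Fin n → ℝ) : ι → ℝ :=
  if h : ∃ θ, IsMLE M Z y θ then h.choose else 0

/-- `E (L_{n,θ_S} - L_{n,θ₀})`, where `E` is expectation under the true law. It differs from
`E L_{n,θ_S}` by a term without `θ_S`, and subtracting that term removes `k(Y_i)`, which need
not be integrable. -/
def expLogLik (M : ExpFamily) (X : Matrix (Fin n) (Fin p) ℝ) (θ₀ : Fin p → ℝ)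
    (S : Finset (Fin p)) (θ : S → ℝ) : ℝ :=
  ∫ y, (logLik M (cols X S) y θ - logLik M X y θ₀) ∂(jointLaw M X θ₀)

open Classical in
/-- The best approximation `θ*_S`, a maximizer of the expected log-likelihood of the model `S`
(the zero vector if there is none). -/
def best (M : ExpFamily) (X : Matrix (Fin n) (Fin p) ℝ) (θ₀ : Fin p → ℝ)
    (S : Finset (Fin p)) : S → ℝ :=
  if h : ∃ θ : S → ℝ, ∀ θ' : S → ℝ, expLogLik M X θ₀ S θ' ≤ expLogLik M X θ₀ S θ
  then h.choose else 0

/-- The Fisher information `F = Zᵀ W_θ Z`, with `W_θ = diag (b''(z_iᵀ θ))`. -/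
def fisher [Fintype ι] (M : ExpFamily) (Z : Matrix (Fin n) ι ℝ) (θ : ι → ℝ) : Matrix ι ι ℝ :=
  Zᵀ * Matrix.diagonal (fun i => deriv (deriv M.b) ((Z *ᵥ θ) i)) * Z

theorem fisher_isHermitian [Fintype ι] (M : ExpFamily) (Z : Matrix (Fin n) ι ℝ) (θ : ι → ℝ) :
    (fisher M Z θ).IsHermitian := by
  unfold fisher Matrix.IsHermitian
  simp [Matrix.conjTranspose_eq_transpose_of_trivial, Matrix.transpose_mul, Matrix.mul_assoc]

/-- The Fisher information `F_{n,θ*_S}` of the model `S` at its best approximation. -/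
def fisherBest (M : ExpFamily) (X : Matrix (Fin n) (Fin p) ℝ) (θ₀ : Fin p → ℝ)
    (S : Finset (Fin p)) : Matrix S S ℝ :=
  fisher M (cols X S) (best M X θ₀ S)

/-- `ρ_{max,S}`, the largest eigenvalue of `F_{n,θ*_S}`. -/
def rhoMax (M : ExpFamily) (X : Matrix (Fin n) (Fin p) ℝ) (θ₀ : Fin p → ℝ)
    (S : Finset (Fin p)) : ℝ :=
  ⨆ j, (fisher_isHermitian M (cols X S) (best M X θ₀ S)).eigenvalues j

/-- `ρ_{min,S}`, the smallest eigenvalue of `F_{n,θ*_S}`. -/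
def rhoMin (M : ExpFamily) (X : Matrix (Fin n) (Fin p) ℝ) (θ₀ : Fin p → ℝ)
    (S : Finset (Fin p)) : ℝ :=
  ⨅ j, (fisher_isHermitian M (cols X S) (best M X θ₀ S)).eigenvalues j

/-- The design regularity `ζ_{n,S} = max_i ‖F^{-1/2} x_{i,S}‖₂` with `F = F_{n,θ*_S}`, written with
`‖F^{-1/2} x‖₂² = xᵀ F⁻¹ x`. -/
def designReg (M : ExpFamily) (X : Matrix (Fin n) (Fin p) ℝ) (θ₀ : Fin p → ℝ)
    (S : Finset (Fin p)) : ℝ :=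
  ⨆ i, Real.sqrt (cols X S i ⬝ᵥ ((fisherBest M X θ₀ S)⁻¹ *ᵥ cols X S i))

/-- The maximal absolute row sum `‖Z‖_∞`. -/
def rowSumNorm [Fintype ι] (Z : Matrix (Fin n) ι ℝ) : ℝ := ⨆ i, ∑ j, |Z i j|

/-- The density at `x` of the normal distribution with mean `m` and covariance matrix `C`. -/
def normalDensity [Fintype ι] [DecidableEq ι] (m : ι → ℝ) (C : Matrix ι ι ℝ) (x : ι → ℝ) : ℝ :=
  (Real.sqrt ((2 * Real.pi) ^ Fintype.card ι * C.det))⁻¹ *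
    Real.exp (-((x - m) ⬝ᵥ (C⁻¹ *ᵥ (x - m))) / 2)

/-- The data-dependent slab density `g_S`, normal with mean the MLE of the model `S` and
covariance matrix `(lam F)⁻¹`, where `F` is the Fisher information at the MLE. -/
def slab (M : ExpFamily) (X : Matrix (Fin n) (Fin p) ℝ) (lam : ℝ) (y : Fin n → ℝ)
    (S : Finset (Fin p)) : (S → ℝ) → ℝ :=
  normalDensity (mle M (cols X S) y) (lam • fisher M (cols X S) (mle M (cols X S) y))⁻¹

/-- The data-dependent prior
`Π_n = ∑_S w(|S|) (p choose |S|)⁻¹ {g_S(θ_S) dθ_S × δ_0(dθ_{Sᶜ})}`. -/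
def prior (M : ExpFamily) (X : Matrix (Fin n) (Fin p) ℝ) (w : ℕ → ℝ) (lam : ℝ) (y : Fin n → ℝ) :
    Measure (Fin p → ℝ) :=
  ∑ S : Finset (Fin p), ENNReal.ofReal (w S.card / (p.choose S.card : ℝ)) •
    ((volume : Measure (S → ℝ)).withDensity
      fun θ => ENNReal.ofReal (slab M X lam y S θ)).map (extend S)

/-- The `α`-fractional posterior probability of `A`. -/
def posterior (M : ExpFamily) (X : Matrix (Fin n) (Fin p) ℝ) (w : ℕ → ℝ) (lam α : ℝ)
    (y : Fin n → ℝ) (A : Set (Fin p → ℝ)) : ℝ≥0∞ :=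
  (∫⁻ θ in A, ENNReal.ofReal (Real.exp (α * logLik M X y θ)) ∂(prior M X w lam y)) /
    ∫⁻ θ, ENNReal.ofReal (Real.exp (α * logLik M X y θ)) ∂(prior M X w lam y)

end GLM

/-- The data of a sequence of sparse regression problems. The index `n` is the sample size, and the
sequence starts at `n = n₀` (entries below `n₀` are irrelevant). -/
structure Regime where
  n₀ : ℕ
  /-- number of covariates -/
  p : ℕ → ℕ
  /-- design matrix -/
  X : ∀ n, Matrix (Fin n) (Fin (p n)) ℝ
  /-- true coefficient vector -/
  θ₀ : ∀ n, Fin (p n) → ℝ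
  /-- upper bound on the model size under the prior -/
  smax : ℕ → ℕ
  /-- prior mass function `w_n` of the model size -/
  w : ℕ → ℕ → ℝ
  /-- prior precision parameter -/
  lam : ℕ → ℝ

namespace Regime

/-- The true model `S₀`. -/
def S₀ (R : Regime) (n : ℕ) : Finset (Fin (R.p n)) := GLM.supp (R.θ₀ n)

/-- The true model size `s₀`. -/
def s₀ (R : Regime) (n : ℕ) : ℕ := (R.S₀ n).card

/-- The true law of the observations. -/
def P₀ (R : Regime) (M : ExpFamily) (n : ℕ) : Measure (Fin n → ℝ) :=
  GLM.jointLaw M (R.X n) (R.θ₀ n)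

/-- The Fisher information of the model `S` at `θ_S`. -/
def F (R : Regime) (M : ExpFamily) (n : ℕ) (S : Finset (Fin (R.p n))) (θ : S → ℝ) :
    Matrix S S ℝ :=
  GLM.fisher M (GLM.cols (R.X n) S) θ

/-- The standing assumptions on the sequence. -/
structure Standing (R : Regime) : Prop where
  theta_ne_zero : ∀ n, R.n₀ ≤ n → R.θ₀ n ≠ 0
  growth : ∃ C : ℝ, 0 < C ∧ ∀ n, R.n₀ ≤ n → (n : ℝ) ^ C ≤ (R.p n : ℝ)
  smax_le_rank : ∀ n, R.n₀ ≤ n → R.smax n ≤ (R.X n).rank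
  s₀_le_smax : ∀ n, R.n₀ ≤ n → R.s₀ n ≤ R.smax n

/-- `w_n` is a probability mass function on `{0, …, smax}` that decays geometrically in the model
size, at rates between `A₁ p^{-A₃}` and `A₂ p^{-A₄}`. -/
structure SizePrior (R : Regime) (A₁ A₂ A₃ A₄ : ℝ) : Prop where
  pos₁ : 0 < A₁
  pos₂ : 0 < A₂
  pos₃ : 0 < A₃
  pos₄ : 0 < A₄
  nonneg : ∀ n, R.n₀ ≤ n → ∀ s, 0 ≤ R.w n s
  sum_eq_one : ∀ n, R.n₀ ≤ n → ∑ s ∈ Finset.range (R.smax n + 1), R.w n s = 1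
  eq_zero : ∀ n, R.n₀ ≤ n → ∀ s, R.smax n < s → R.w n s = 0
  lower : ∀ n, R.n₀ ≤ n → ∀ s, 1 ≤ s → s ≤ R.smax n →
    A₁ * (R.p n : ℝ) ^ (-A₃) * R.w n (s - 1) ≤ R.w n s
  upper : ∀ n, R.n₀ ≤ n → ∀ s, 1 ≤ s → s ≤ R.smax n →
    R.w n s ≤ A₂ * (R.p n : ℝ) ^ (-A₄) * R.w n (s - 1)

/-- Condition (A1), for non-random `D n` and `θbar n S`. Matrices are compared in the Loewner order,
`D⁻¹ I ⪯ F̂ F̄⁻¹ ⪯ D I` being read as `D⁻¹ F̄ ⪯ F̂ ⪯ D F̄`, and `‖F̄^{1/2} v‖₂²` is `vᵀ F̄ v`. -/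
structure CondA1 (R : Regime) (M : ExpFamily) (D : ℕ → ℝ)
    (θbar : ∀ n, ∀ S : Finset (Fin (R.p n)), S → ℝ) : Prop where
  sqrt_two_lt : ∀ n, R.n₀ ≤ n → Real.sqrt 2 < D n
  nonsingular_bar : ∀ n, R.n₀ ≤ n → ∀ S : Finset (Fin (R.p n)), S.card ≤ R.smax n →
    IsUnit (R.F M n S (θbar n S)).det
  mle_close : ∀ n, R.n₀ ≤ n →
    ENNReal.ofReal (1 - (R.p n : ℝ)⁻¹) ≤ R.P₀ M n
      {y | ∀ S : Finset (Fin (R.p n)), S.card ≤ R.smax n →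
        (∃ θ, GLM.IsMLE M (GLM.cols (R.X n) S) y θ) ∧
        (R.F M n S (GLM.mle M (GLM.cols (R.X n) S) y) -
          (D n)⁻¹ • R.F M n S (θbar n S)).PosSemidef ∧
        (D n • R.F M n S (θbar n S) -
          R.F M n S (GLM.mle M (GLM.cols (R.X n) S) y)).PosSemidef ∧
        (GLM.mle M (GLM.cols (R.X n) S) y - θbar n S) ⬝ᵥ
            (R.F M n S (θbar n S) *ᵥ (GLM.mle M (GLM.cols (R.X n) S) y - θbar n S))
          ≤ D n * (S.card : ℝ) * Real.log (R.p n)}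
  nonsingular_best : ∀ n, R.n₀ ≤ n → IsUnit (GLM.fisherBest M (R.X n) (R.θ₀ n) (R.S₀ n)).det
  designReg_small : (fun n => GLM.designReg M (R.X n) (R.θ₀ n) (R.S₀ n) ^ 2 * (R.s₀ n : ℝ) *
    Real.log (R.p n)) =o[atTop] fun _ => (1 : ℝ)

/-- Condition (A2), where `A₄` is the constant of the prior on the model size and `D` is the
sequence of condition (A1). -/
structure CondA2 (R : Regime) (M : ExpFamily) (D : ℕ → ℝ) (α A₄ A₅ A₆ A₇ : ℝ) : Prop where
  log_bound : (fun n => Real.log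
      (max (max (max (⨆ i, deriv (deriv M.b) ((R.X n *ᵥ R.θ₀ n) i))
        (GLM.rowSumNorm (GLM.cols (R.X n) (R.S₀ n))))
        (GLM.rhoMin M (R.X n) (R.θ₀ n) (R.S₀ n))⁻¹)
        (GLM.rhoMax M (R.X n) (R.θ₀ n) (R.S₀ n))))
    =O[atTop] fun n => Real.log (R.p n)
  sparsity : (fun n => (R.s₀ n : ℝ) * Real.log (R.p n)) =o[atTop] fun n => (n : ℝ)
  pos₅ : 0 < A₅
  pos₆ : 0 < A₆
  nonneg₇ : 0 ≤ A₇
  lam_lower : ∀ n, R.n₀ ≤ n → (R.p n : ℝ) ^ (-A₅) ≤ R.lam n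
  lam_upper : ∀ n, R.n₀ ≤ n → R.lam n ≤ A₆ * (R.p n : ℝ) ^ (-A₇)
  alpha_pos : 0 < α
  alpha_lt_one : α < 1
  lt_A₄ : ∀ n, R.n₀ ≤ n → A₆ * (R.p n : ℝ) ^ (-A₇) < A₄
  logb_D : (fun n => Real.logb (R.p n) (D n)) =o[atTop] fun _ => (1 : ℝ)

end Regime

end

/-!
The posterior mass of large models is bounded, outside two events of probability at most `p⁻¹` each, by
a ratio `mixture / evidenceBound`, and the ratio has expectation at most `p ^ (-s₀)`.

*Numerator.* The slab of a model `S` depends on the data through the estimator and its Fisher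
information. On the event of `Regime.CondA1` it is dominated by `p ^ (λ |S| / 2) (√2 D) ^ |S|` times
a deterministic normal density (`GLM.normalDensity_le`). Under the truth a fractional likelihood
ratio has expectation at most one, by convexity of `b` (`GLM.lintegral_exp_logLik_le`). With
Tonelli's theorem the expected numerator is therefore at most the sum of the inflated prior weights
of the large models (`GLM.lintegral_mixture_le`), and since `λ < A₄` and `D = p ^ o(1)` the prior
decay `p ^ (-A₄)` per covariate beats the inflation (`GLM.sum_inflatedWeight_le`).

*Denominator.* Only the true model is kept. Its best approximation has the true linear predictor,
so the condition on `F_{n,θ*_{S₀}}` is one on the information at the truth. By a Chernoff bound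
(`GLM.score_tail`) the whitened score is of order `√(log p)` in each coordinate, and concavity of
the likelihood then forces the estimator of the true model to be close to the truth
(`GLM.abs_mulVec_sub_le`). This makes its Fisher information comparable with that at the truth, and
integrating over a cube of polynomially small width around it gives a lower bound
`w_n(s₀) p ^ (-C s₀)` relative to the likelihood of the truth (`GLM.evidenceBound_le`,
`GLM.le_evidenceBound`).

A large dimension factor makes the ratio at most `p ^ (-s₀)`. All this holds for `n` beyond some
`N`. For the finitely many other `n` a factor exceeding `N` suffices, as the prior does not charge
models with more than `rank X ≤ n` covariates.
-/

/-! ### The cumulant function and one-dimensional laws -/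

/-- A function on the line with nonnegative second derivative near a critical point is bounded
below by its value there. -/
theorem nonneg_of_deriv2_nonneg {g : ℝ → ℝ} {r : ℝ} (hg : Differentiable ℝ g)
    (hg' : Differentiable ℝ (deriv g)) (h2 : ∀ v, |v| ≤ r → 0 ≤ deriv (deriv g) v)
    (h0 : g 0 = 0) (h1 : deriv g 0 = 0) {u : ℝ} (hu : |u| ≤ r) : 0 ≤ g u := by
  have hr : 0 ≤ r := (abs_nonneg u).trans hu
  have hconv : ConvexOn ℝ (Set.Icc (-r) r) g := by
    refine convexOn_of_deriv2_nonneg (convex_Icc _ _) hg.continuous.continuousOn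
      hg.differentiableOn hg'.differentiableOn fun x hx => ?_
    exact h2 x (abs_le.2 (Set.mem_Icc.1 (interior_subset hx)))
  have hd : HasDerivAt g 0 0 := by simpa [h1] using (hg 0).hasDerivAt
  have h0m : (0 : ℝ) ∈ Set.Icc (-r) r := ⟨by linarith, hr⟩
  have hum : u ∈ Set.Icc (-r) r := abs_le.1 hu
  rcases lt_trichotomy u 0 with h | h | h
  · have := hconv.slope_le_of_hasDerivAt hum h0m h hd
    rw [slope_def_field, h0] at this
    rw [div_nonpos_iff] at this
    rcases this with h' | h' <;> linarith [h'.1, h'.2]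
  · rw [h, h0]
  · have := hconv.le_slope_of_hasDerivAt h0m hum h hd
    rw [slope_def_field, h0] at this
    rw [div_nonneg_iff] at this
    rcases this with h' | h' <;> linarith [h'.1, h'.2]

namespace ExpFamily

variable (M : ExpFamily)

/-- A constant controlling the local growth of the variance function `b''`. -/
noncomputable def Cdev : ℝ := M.exists_Cdev.choose

theorem one_le_Cdev : 1 ≤ M.Cdev := M.exists_Cdev.choose_spec.1

theorem Cdev_pos : 0 < M.Cdev := one_pos.trans_le M.one_le_Cdev

theorem var_le {x y : ℝ} (h : |y| ≤ 1 / 2) :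
    deriv (deriv M.b) (x + y) ≤ M.Cdev * deriv (deriv M.b) x :=
  M.exists_Cdev.choose_spec.2 x y h

theorem le_var {x y : ℝ} (h : |y| ≤ 1 / 2) :
    M.Cdev⁻¹ * deriv (deriv M.b) x ≤ deriv (deriv M.b) (x + y) := by
  rw [inv_mul_le_iff₀ M.Cdev_pos]
  simpa using M.var_le (x := x + y) (y := -y) (by simpa using h)

theorem strictMono_deriv_b : StrictMono (deriv M.b) := by
  have := M.strictConvexOn_b.strictMonoOn_deriv fun x _ => M.differentiable_b x
  exact strictMonoOn_univ.1 this

/-- A zero of the variance function would propagate to a neighbourhood, on which the mean function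
`b'` could not be strictly increasing. -/
theorem var_pos (x : ℝ) : 0 < deriv (deriv M.b) x := by
  by_contra! h
  have hanti : AntitoneOn (deriv M.b) (Set.Icc x (x + 1 / 2)) := by
    refine antitoneOn_of_deriv_nonpos (convex_Icc _ _)
      M.differentiable_deriv_b.continuous.continuousOn M.differentiable_deriv_b.differentiableOn
      fun z hz => ?_
    have hz' := interior_subset hz
    have := M.var_le (x := x) (y := z - x) (by
      rw [abs_le]; constructor <;> linarith [hz'.1, hz'.2])
    rw [add_sub_cancel] at this
    exact this.trans (mul_nonpos_of_nonneg_of_nonpos M.Cdev_pos.le h)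
  have h1 := hanti (Set.left_mem_Icc.2 (by linarith)) (Set.right_mem_Icc.2 (by linarith))
    (by linarith : x ≤ x + 1 / 2)
  have h2 := M.strictMono_deriv_b (by linarith : x < x + 1 / 2)
  linarith

theorem continuous_b : Continuous M.b := M.differentiable_b.continuous

theorem continuous_deriv_b : Continuous (deriv M.b) := M.differentiable_deriv_b.continuous

theorem continuous_var : Continuous (deriv (deriv M.b)) := M.differentiable_deriv2_b.continuous

theorem tangent_lt {x z : ℝ} (h : x ≠ z) : M.b x + deriv M.b x * (z - x) < M.b z := by
  rcases h.lt_or_gt with h | h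
  · have := M.strictConvexOn_b.deriv_lt_slope (Set.mem_univ x) (Set.mem_univ z) h
      (M.differentiable_b x)
    rw [slope_def_field, lt_div_iff₀ (by linarith)] at this
    linarith
  · have := M.strictConvexOn_b.slope_lt_deriv (Set.mem_univ z) (Set.mem_univ x) h
      (M.differentiable_b x)
    rw [slope_def_field, div_lt_iff₀ (by linarith)] at this
    nlinarith

theorem tangent_le (x z : ℝ) : M.b x + deriv M.b x * (z - x) ≤ M.b z := by
  rcases eq_or_ne x z with rfl | h
  · simp
  · exact (M.tangent_lt h).le

theorem hasDerivAt_shift (x u : ℝ) : HasDerivAt (fun u => M.b (x + u)) (deriv M.b (x + u)) u :=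
  ((M.differentiable_b (x + u)).hasDerivAt).comp_const_add x u

theorem hasDerivAt_deriv_shift (x u : ℝ) :
    HasDerivAt (fun u => deriv M.b (x + u)) (deriv (deriv M.b) (x + u)) u :=
  ((M.differentiable_deriv_b (x + u)).hasDerivAt).comp_const_add x u

/-- Comparison of the Bregman remainder of `b` with a parabola, upper bound. -/
theorem breg_le {x u : ℝ} (hu : |u| ≤ 1 / 2) :
    M.b (x + u) - M.b x - deriv M.b x * u ≤ M.Cdev / 2 * (deriv (deriv M.b) x * u ^ 2) := by
  set c := M.Cdev * deriv (deriv M.b) x with hc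
  have h1 : ∀ v, HasDerivAt (fun v => c / 2 * v ^ 2 - (M.b (x + v) - M.b x - deriv M.b x * v))
      (c * v - (deriv M.b (x + v) - deriv M.b x)) v := by
    intro v
    have := (((hasDerivAt_pow 2 v).const_mul (c / 2))).sub
      (((M.hasDerivAt_shift x v).sub_const (M.b x)).sub ((hasDerivAt_id v).const_mul (deriv M.b x)))
    refine this.congr_deriv ?_
    norm_num; ring
  have h2 : ∀ v, HasDerivAt (fun v => c * v - (deriv M.b (x + v) - deriv M.b x))
      (c - deriv (deriv M.b) (x + v)) v := by
    intro v
    have := ((hasDerivAt_id v).const_mul c).sub ((M.hasDerivAt_deriv_shift x v).sub_const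
      (deriv M.b x))
    refine this.congr_deriv ?_
    simp
  have e1 := funext fun v => (h1 v).deriv
  have := nonneg_of_deriv2_nonneg (fun v => (h1 v).differentiableAt)
    (by rw [e1]; exact fun v => (h2 v).differentiableAt)
    (fun v (hv : |v| ≤ 1 / 2) => by
      rw [e1, (h2 v).deriv]; linarith [M.var_le (x := x) hv]) (by simp) (by rw [e1]; simp) hu
  simp only [hc] at this
  linarith

/-- Comparison of the Bregman remainder of `b` with a parabola, lower bound. -/
theorem le_breg {x u : ℝ} (hu : |u| ≤ 1 / 2) :
    M.Cdev⁻¹ / 2 * (deriv (deriv M.b) x * u ^ 2) ≤ M.b (x + u) - M.b x - deriv M.b x * u := by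
  set c := M.Cdev⁻¹ * deriv (deriv M.b) x with hc
  have h1 : ∀ v, HasDerivAt (fun v => (M.b (x + v) - M.b x - deriv M.b x * v) - c / 2 * v ^ 2)
      ((deriv M.b (x + v) - deriv M.b x) - c * v) v := by
    intro v
    have := (((M.hasDerivAt_shift x v).sub_const (M.b x)).sub
      ((hasDerivAt_id v).const_mul (deriv M.b x))).sub ((hasDerivAt_pow 2 v).const_mul (c / 2))
    refine this.congr_deriv ?_
    norm_num; ring
  have h2 : ∀ v, HasDerivAt (fun v => (deriv M.b (x + v) - deriv M.b x) - c * v)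
      (deriv (deriv M.b) (x + v) - c) v := by
    intro v
    have := ((M.hasDerivAt_deriv_shift x v).sub_const (deriv M.b x)).sub
      ((hasDerivAt_id v).const_mul c)
    refine this.congr_deriv ?_
    simp
  have e1 := funext fun v => (h1 v).deriv
  have := nonneg_of_deriv2_nonneg (fun v => (h1 v).differentiableAt)
    (by rw [e1]; exact fun v => (h2 v).differentiableAt)
    (fun v (hv : |v| ≤ 1 / 2) => by
      rw [e1, (h2 v).deriv]; linarith [M.le_var (x := x) hv]) (by simp) (by rw [e1]; simp) hu
  simp only [hc] at this
  linarith

end ExpFamily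

namespace GLM

theorem measurable_density (M : ExpFamily) (η : ℝ) :
    Measurable fun y => ENNReal.ofReal (Real.exp (y * η - M.b η + M.k y)) := by
  have := M.measurable_k
  fun_prop

instance isProbabilityMeasure_law (M : ExpFamily) (η : ℝ) : IsProbabilityMeasure (law M η) :=
  ⟨by rw [law, withDensity_apply _ MeasurableSet.univ, Measure.restrict_univ,
    M.lintegral_density η]⟩

/-- The Laplace transform of `p_η`, read off from the normalization of `p_{η + t}`. -/
theorem lintegral_exp_law (M : ExpFamily) (η t : ℝ) :
    ∫⁻ y, ENNReal.ofReal (Real.exp (t * y)) ∂(law M η) =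
      ENNReal.ofReal (Real.exp (M.b (η + t) - M.b η)) := by
  rw [law, lintegral_withDensity_eq_lintegral_mul _ (measurable_density M η) (by fun_prop)]
  have : ∀ y, ((fun y => ENNReal.ofReal (Real.exp (y * η - M.b η + M.k y))) *
      fun y => ENNReal.ofReal (Real.exp (t * y))) y =
      ENNReal.ofReal (Real.exp (M.b (η + t) - M.b η)) *
        ENNReal.ofReal (Real.exp (y * (η + t) - M.b (η + t) + M.k y)) := by
    intro y
    simp only [Pi.mul_apply]
    rw [← ENNReal.ofReal_mul (Real.exp_pos _).le, ← ENNReal.ofReal_mul (Real.exp_pos _).le,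
      ← Real.exp_add, ← Real.exp_add]
    congr 2; ring
  rw [lintegral_congr this, lintegral_const_mul _ (measurable_density M _),
    M.lintegral_density, mul_one]

theorem integrable_exp_law (M : ExpFamily) (η t : ℝ) :
    Integrable (fun y => Real.exp (t * y)) (law M η) := by
  refine ⟨by fun_prop, ?_⟩
  rw [hasFiniteIntegral_iff_ofReal (Eventually.of_forall fun y => (Real.exp_pos _).le),
    lintegral_exp_law]
  exact ENNReal.ofReal_lt_top

theorem mgf_law (M : ExpFamily) (η t : ℝ) :
    ProbabilityTheory.mgf id (law M η) t = Real.exp (M.b (η + t) - M.b η) := by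
  rw [ProbabilityTheory.mgf, integral_eq_lintegral_of_nonneg_ae
    (Eventually.of_forall fun y => (Real.exp_pos _).le) (by simp only [id]; fun_prop)]
  simp only [id]
  rw [lintegral_exp_law, ENNReal.toReal_ofReal (Real.exp_pos _).le]

theorem zero_mem_interior_integrableExpSet (M : ExpFamily) (η : ℝ) :
    0 ∈ interior (ProbabilityTheory.integrableExpSet id (law M η)) := by
  have : ProbabilityTheory.integrableExpSet id (law M η) = Set.univ :=
    Set.eq_univ_of_forall fun t => integrable_exp_law M η t
  simp [this]

theorem integrable_law (M : ExpFamily) (η : ℝ) : Integrable (fun y => y) (law M η) :=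
  ProbabilityTheory.integrable_of_mem_interior_integrableExpSet
    (zero_mem_interior_integrableExpSet M η)

/-- The mean of `p_η` is `b'(η)`. -/
theorem integral_law (M : ExpFamily) (η : ℝ) : ∫ y, y ∂(law M η) = deriv M.b η := by
  have h := ProbabilityTheory.deriv_mgf_zero (zero_mem_interior_integrableExpSet M η)
  have e : ProbabilityTheory.mgf id (law M η) = fun t => Real.exp (M.b (η + t) - M.b η) :=
    funext (mgf_law M η)
  have hd : HasDerivAt (fun t => Real.exp (M.b (η + t) - M.b η)) (deriv M.b η) 0 := by
    have := ((M.hasDerivAt_shift η 0).sub_const (M.b η)).exp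
    simpa using this
  rw [e, hd.deriv] at h
  simpa using h.symm

end GLM

/-! ### The joint law of the observations -/

namespace GLM

variable {n p : ℕ} {ι : Type*}

instance isProbabilityMeasure_jointLaw (M : ExpFamily) (X : Matrix (Fin n) (Fin p) ℝ)
    (θ : Fin p → ℝ) : IsProbabilityMeasure (jointLaw M X θ) := by
  unfold jointLaw; infer_instance

theorem lintegral_exp_jointLaw (M : ExpFamily) (X : Matrix (Fin n) (Fin p) ℝ) (θ : Fin p → ℝ)
    (c : Fin n → ℝ) :
    ∫⁻ y, ENNReal.ofReal (Real.exp (∑ i, c i * y i)) ∂(jointLaw M X θ) =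
      ENNReal.ofReal (Real.exp (∑ i, (M.b ((X *ᵥ θ) i + c i) - M.b ((X *ᵥ θ) i)))) := by
  have hind : ProbabilityTheory.iIndepFun
      (fun i (y : Fin n → ℝ) => ENNReal.ofReal (Real.exp (c i * y i))) (jointLaw M X θ) :=
    ProbabilityTheory.iIndepFun_pi (X := fun i (y : ℝ) => ENNReal.ofReal (Real.exp (c i * y)))
      fun i => by fun_prop
  have h1 : ∀ y : Fin n → ℝ, ENNReal.ofReal (Real.exp (∑ i, c i * y i)) =
      ∏ i, ENNReal.ofReal (Real.exp (c i * y i)) := fun y => by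
    rw [Real.exp_sum, ENNReal.ofReal_prod_of_nonneg fun i _ => (Real.exp_pos _).le]
  rw [lintegral_congr h1,
    ProbabilityTheory.lintegral_prod_eq_prod_lintegral_of_indepFun _ _ hind fun i => by fun_prop,
    Real.exp_sum, ENNReal.ofReal_prod_of_nonneg fun i _ => (Real.exp_pos _).le]
  refine Finset.prod_congr rfl fun i _ => ?_
  have hmp := measurePreserving_eval (fun i => law M ((X *ᵥ θ) i)) i
  have := hmp.lintegral_comp (f := fun y => ENNReal.ofReal (Real.exp (c i * y))) (by fun_prop)
  exact this.trans (lintegral_exp_law M _ _)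

theorem logLik_sub [Fintype ι] (M : ExpFamily) (X : Matrix (Fin n) (Fin p) ℝ)
    (Z : Matrix (Fin n) ι ℝ) (y : Fin n → ℝ) (θ : ι → ℝ) (θ₀ : Fin p → ℝ) :
    logLik M Z y θ - logLik M X y θ₀ =
      ∑ i, (y i * ((Z *ᵥ θ) i - (X *ᵥ θ₀) i) - (M.b ((Z *ᵥ θ) i) - M.b ((X *ᵥ θ₀) i))) := by
  rw [logLik, logLik, ← Finset.sum_sub_distrib]
  exact Finset.sum_congr rfl fun i _ => by ring

/-- Fractional likelihood ratios have expectation at most one, since `b` is convex. -/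
theorem lintegral_exp_logLik_le [Fintype ι] (M : ExpFamily) (X : Matrix (Fin n) (Fin p) ℝ)
    (Z : Matrix (Fin n) ι ℝ) (θ : ι → ℝ) (θ₀ : Fin p → ℝ) {α : ℝ} (h0 : 0 ≤ α) (h1 : α ≤ 1) :
    ∫⁻ y, ENNReal.ofReal (Real.exp (α * (logLik M Z y θ - logLik M X y θ₀))) ∂(jointLaw M X θ₀)
      ≤ 1 := by
  set z := Z *ᵥ θ with hz
  set η := X *ᵥ θ₀ with hη
  have h : ∀ y : Fin n → ℝ,
      ENNReal.ofReal (Real.exp (α * (logLik M Z y θ - logLik M X y θ₀))) =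
      ENNReal.ofReal (Real.exp (-∑ i, α * (M.b (z i) - M.b (η i)))) *
        ENNReal.ofReal (Real.exp (∑ i, (α * (z i - η i)) * y i)) := fun y => by
    rw [← ENNReal.ofReal_mul (Real.exp_pos _).le, ← Real.exp_add, logLik_sub, Finset.mul_sum,
      ← Finset.sum_neg_distrib, ← Finset.sum_add_distrib]
    congr 2
    exact Finset.sum_congr rfl fun i _ => by ring
  rw [lintegral_congr h, lintegral_const_mul _ (by fun_prop), lintegral_exp_jointLaw,
    ← ENNReal.ofReal_mul (Real.exp_pos _).le, ← Real.exp_add]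
  refine ENNReal.ofReal_le_one.2 (Real.exp_le_one_iff.2 ?_)
  rw [← Finset.sum_neg_distrib, ← Finset.sum_add_distrib]
  refine Finset.sum_nonpos fun i _ => ?_
  have := M.strictConvexOn_b.convexOn.2 (Set.mem_univ (η i)) (Set.mem_univ (z i))
    (sub_nonneg.2 h1) h0 (by ring)
  simp only [smul_eq_mul] at this
  rw [show (1 - α) * η i + α * z i = η i + α * (z i - η i) by ring] at this
  rw [← hη]
  linarith

/-- Chernoff bound for a linear combination of the centred observations that is normalized to have
unit variance. -/
theorem linear_tail (M : ExpFamily) (X : Matrix (Fin n) (Fin p) ℝ) (θ₀ : Fin p → ℝ)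
    (a : Fin n → ℝ) {t τ : ℝ} (ha : ∀ i, |t * a i| ≤ 1 / 2)
    (hv : ∑ i, deriv (deriv M.b) ((X *ᵥ θ₀) i) * a i ^ 2 = 1) :
    jointLaw M X θ₀ {y | t * τ ≤ t * ∑ i, a i * (y i - deriv M.b ((X *ᵥ θ₀) i))} ≤
      ENNReal.ofReal (Real.exp (M.Cdev / 2 * t ^ 2 - t * τ)) := by
  set η := X *ᵥ θ₀ with hη
  have hsum : ∀ y : Fin n → ℝ, t * ∑ i, a i * (y i - deriv M.b (η i)) =
      ∑ i, (t * a i) * y i - ∑ i, t * a i * deriv M.b (η i) := fun y => by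
    rw [Finset.mul_sum, ← Finset.sum_sub_distrib]
    exact Finset.sum_congr rfl fun i _ => by ring
  have hbound : ∑ i, (M.b (η i + t * a i) - M.b (η i)) - ∑ i, t * a i * deriv M.b (η i) ≤
      M.Cdev / 2 * t ^ 2 := by
    rw [← Finset.sum_sub_distrib]
    calc ∑ i, (M.b (η i + t * a i) - M.b (η i) - t * a i * deriv M.b (η i))
        ≤ ∑ i, M.Cdev / 2 * t ^ 2 * (deriv (deriv M.b) (η i) * a i ^ 2) :=
          Finset.sum_le_sum fun i _ => by
            have := M.breg_le (x := η i) (ha i)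
            nlinarith
      _ = M.Cdev / 2 * t ^ 2 := by rw [← Finset.mul_sum, hv, mul_one]
  have hmark := meas_ge_le_lintegral_div (μ := jointLaw M X θ₀)
    (f := fun y => ENNReal.ofReal (Real.exp (∑ i, (t * a i) * y i)))
    (Measurable.aemeasurable (by fun_prop))
    (ε := ENNReal.ofReal (Real.exp (t * τ + ∑ i, t * a i * deriv M.b (η i))))
    (by simpa using Real.exp_pos _) ENNReal.ofReal_ne_top
  rw [lintegral_exp_jointLaw, ← ENNReal.ofReal_div_of_pos (Real.exp_pos _), ← Real.exp_sub,
    ← hη] at hmark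
  refine (measure_mono fun y hy => ?_).trans (hmark.trans ?_)
  · simp only [Set.mem_ofPred_eq] at hy ⊢
    rw [hsum] at hy
    exact ENNReal.ofReal_le_ofReal (Real.exp_le_exp.2 (by linarith))
  · exact ENNReal.ofReal_le_ofReal (Real.exp_le_exp.2 (by linarith))

/-- Union bound over the coordinates of a normalized score vector. -/
theorem score_tail [Fintype ι] (M : ExpFamily) (X : Matrix (Fin n) (Fin p) ℝ) (θ₀ : Fin p → ℝ)
    (A : Matrix (Fin n) ι ℝ) {t τ : ℝ} (ht : 0 < t) (ha : ∀ i j, |t * A i j| ≤ 1 / 2)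
    (hv : ∀ j, ∑ i, deriv (deriv M.b) ((X *ᵥ θ₀) i) * A i j ^ 2 = 1) :
    jointLaw M X θ₀ {y | ∃ j, τ < |∑ i, A i j * (y i - deriv M.b ((X *ᵥ θ₀) i))|} ≤
      ENNReal.ofReal (2 * Fintype.card ι * Real.exp (M.Cdev / 2 * t ^ 2 - t * τ)) := by
  set η := X *ᵥ θ₀ with hη
  have hone : ∀ j, jointLaw M X θ₀ {y | τ < |∑ i, A i j * (y i - deriv M.b (η i))|} ≤
      ENNReal.ofReal (2 * Real.exp (M.Cdev / 2 * t ^ 2 - t * τ)) := fun j => by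
    have hp := linear_tail M X θ₀ (fun i => A i j) (t := t) (τ := τ) (fun i => ha i j) (hv j)
    have hm := linear_tail M X θ₀ (fun i => A i j) (t := -t) (τ := -τ)
      (fun i => by simpa using ha i j) (hv j)
    rw [two_mul, ENNReal.ofReal_add (Real.exp_pos _).le (Real.exp_pos _).le]
    rw [neg_sq, neg_mul_neg] at hm
    refine (measure_mono fun y hy => ?_).trans ((measure_union_le _ _).trans (add_le_add hp hm))
    simp only [Set.mem_ofPred_eq, Set.mem_union] at hy ⊢
    rcases lt_abs.1 hy with h | h
    · exact Or.inl (by rw [← hη]; nlinarith)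
    · exact Or.inr (by rw [← hη]; nlinarith)
  rw [Set.ofPred_exists]
  refine (measure_iUnion_fintype_le _ _).trans ((Finset.sum_le_sum fun j _ => hone j).trans ?_)
  rw [Finset.sum_const, nsmul_eq_mul, Finset.card_univ, ← ENNReal.ofReal_natCast,
    ← ENNReal.ofReal_mul (by positivity)]
  exact ENNReal.ofReal_le_ofReal (by linarith)

theorem integrable_eval (M : ExpFamily) (X : Matrix (Fin n) (Fin p) ℝ) (θ₀ : Fin p → ℝ)
    (i : Fin n) : Integrable (fun y : Fin n → ℝ => y i) (jointLaw M X θ₀) :=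
  (measurePreserving_eval (fun i => law M ((X *ᵥ θ₀) i)) i).integrable_comp_of_integrable
    (integrable_law M _)

theorem integral_eval (M : ExpFamily) (X : Matrix (Fin n) (Fin p) ℝ) (θ₀ : Fin p → ℝ)
    (i : Fin n) : ∫ y : Fin n → ℝ, y i ∂(jointLaw M X θ₀) = deriv M.b ((X *ᵥ θ₀) i) := by
  have hmp := measurePreserving_eval (fun i => law M ((X *ᵥ θ₀) i)) i
  rw [← integral_law, ← hmp.map_eq, integral_map (measurable_pi_apply i).aemeasurable
    (by fun_prop)]
  rfl

theorem expLogLik_eq (M : ExpFamily) (X : Matrix (Fin n) (Fin p) ℝ) (θ₀ : Fin p → ℝ)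
    (S : Finset (Fin p)) (θ : S → ℝ) :
    expLogLik M X θ₀ S θ = ∑ i, (deriv M.b ((X *ᵥ θ₀) i) * ((cols X S *ᵥ θ) i - (X *ᵥ θ₀) i) -
      (M.b ((cols X S *ᵥ θ) i) - M.b ((X *ᵥ θ₀) i))) := by
  unfold expLogLik
  simp_rw [logLik_sub]
  rw [integral_finsetSum]
  swap
  · exact fun i _ => ((integrable_eval M X θ₀ i).mul_const _).sub (integrable_const _)
  refine Finset.sum_congr rfl fun i _ => ?_
  rw [integral_sub ((integrable_eval M X θ₀ i).mul_const _) (integrable_const _),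
    integral_mul_const, integral_eval]
  simp

theorem cols_mulVec (X : Matrix (Fin n) (Fin p) ℝ) (S : Finset (Fin p)) (θ : S → ℝ) :
    cols X S *ᵥ θ = X *ᵥ extend S θ := by
  funext i
  simp only [Matrix.mulVec, dotProduct, cols, Matrix.submatrix_apply, id]
  rw [← Finset.sum_subset (Finset.subset_univ S), ← Finset.sum_coe_sort S]
  · exact Finset.sum_congr rfl fun j _ => by simp [extend]
  · intro j _ hj; simp [extend, hj]

theorem logLik_extend (M : ExpFamily) (X : Matrix (Fin n) (Fin p) ℝ) (S : Finset (Fin p))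
    (y : Fin n → ℝ) (θ : S → ℝ) : logLik M X y (extend S θ) = logLik M (cols X S) y θ := by
  simp only [logLik, cols_mulVec]

theorem cols_supp_mulVec (X : Matrix (Fin n) (Fin p) ℝ) (θ : Fin p → ℝ) :
    cols X (supp θ) *ᵥ (fun j => θ j) = X *ᵥ θ := by
  rw [cols_mulVec]
  congr 1
  funext j
  by_cases h : θ j = 0 <;> simp [extend, supp, h]

/-- On the true support the best approximation reproduces the true linear predictor. -/
theorem cols_mulVec_best (M : ExpFamily) (X : Matrix (Fin n) (Fin p) ℝ) (θ₀ : Fin p → ℝ) :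
    cols X (supp θ₀) *ᵥ best M X θ₀ (supp θ₀) = X *ᵥ θ₀ := by
  have hle : ∀ θ, expLogLik M X θ₀ (supp θ₀) θ ≤ 0 := fun θ => by
    rw [expLogLik_eq]
    exact Finset.sum_nonpos fun i _ => by
      linarith [M.tangent_le ((X *ᵥ θ₀) i) ((cols X (supp θ₀) *ᵥ θ) i)]
  have h0 : expLogLik M X θ₀ (supp θ₀) (fun j => θ₀ j) = 0 := by
    rw [expLogLik_eq, cols_supp_mulVec]; simp
  have hex : ∃ θ : supp θ₀ → ℝ, ∀ θ' : supp θ₀ → ℝ,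
      expLogLik M X θ₀ (supp θ₀) θ' ≤ expLogLik M X θ₀ (supp θ₀) θ :=
    ⟨_, fun θ' => (hle θ').trans h0.ge⟩
  have hb : best M X θ₀ (supp θ₀) = hex.choose := by rw [best, dif_pos hex]
  have hz : expLogLik M X θ₀ (supp θ₀) (best M X θ₀ (supp θ₀)) = 0 := by
    refine le_antisymm (hle _) ?_
    rw [hb, ← h0]; exact hex.choose_spec _
  rw [expLogLik_eq, Finset.sum_eq_zero_iff_of_nonpos fun i _ => by
    linarith [M.tangent_le ((X *ᵥ θ₀) i) ((cols X (supp θ₀) *ᵥ best M X θ₀ (supp θ₀)) i)]] at hz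
  funext i
  by_contra hne
  linarith [hz i (Finset.mem_univ i), M.tangent_lt (Ne.symm hne)]

end GLM

/-! ### Positive definite matrices and Gaussian integrals -/

namespace Matrix

variable {ι : Type*} [Fintype ι]

theorem dotProduct_transpose_mul_self_mulVec (B : Matrix ι ι ℝ) (x : ι → ℝ) :
    x ⬝ᵥ ((Bᵀ * B) *ᵥ x) = ∑ i, (B *ᵥ x) i ^ 2 := by
  rw [← mulVec_mulVec, dotProduct_mulVec, vecMul_transpose, dotProduct]
  exact Finset.sum_congr rfl fun i _ => by ring

theorem lintegral_exp_neg_sum_sq :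
    ∫⁻ x : ι → ℝ, ENNReal.ofReal (Real.exp (-(∑ i, x i ^ 2) / 2)) =
      ENNReal.ofReal (Real.sqrt ((2 * Real.pi) ^ Fintype.card ι)) := by
  have hprod : ∀ x : ι → ℝ, Real.exp (-(∑ i, x i ^ 2) / 2) =
      ∏ i, Real.exp (-(1 / 2) * x i ^ 2) := fun x => by
    rw [← Real.exp_sum, ← Finset.mul_sum]; congr 1; ring
  have hint : Integrable fun x : ι → ℝ => ∏ i, Real.exp (-(1 / 2) * x i ^ 2) :=
    Integrable.fintype_prod fun _ => integrable_exp_neg_mul_sq (by norm_num)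
  simp_rw [hprod]
  rw [← ofReal_integral_eq_lintegral_ofReal hint
      (Eventually.of_forall fun x => Finset.prod_nonneg fun i _ => (Real.exp_pos _).le),
    integral_fintype_prod_volume_eq_pow (fun x : ℝ => Real.exp (-(1 / 2) * x ^ 2)),
    integral_gaussian]
  congr 1
  rw [Real.sqrt_eq_rpow, Real.sqrt_eq_rpow, ← Real.rpow_natCast, ← Real.rpow_natCast,
    ← Real.rpow_mul (by positivity), ← Real.rpow_mul (by positivity), mul_comm]
  congr 1
  ring

variable [DecidableEq ι]

open scoped MatrixOrder in
theorem PosDef.exists_eq_transpose_mul_self {F : Matrix ι ι ℝ} (hF : F.PosDef) :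
    ∃ B : Matrix ι ι ℝ, F = Bᵀ * B ∧ B.det ≠ 0 := by
  obtain ⟨B, hB⟩ := CStarAlgebra.nonneg_iff_eq_star_mul_self.mp hF.posSemidef.nonneg
  rw [star_eq_conjTranspose, conjTranspose_eq_transpose_of_trivial] at hB
  refine ⟨B, hB, fun h => ?_⟩
  have := hF.det_pos
  rw [hB, det_mul, h, mul_zero] at this
  exact this.false

/-- The Gaussian integral of a positive definite quadratic form. -/
theorem PosDef.lintegral_exp_neg {F : Matrix ι ι ℝ} (hF : F.PosDef) :
    ∫⁻ x : ι → ℝ, ENNReal.ofReal (Real.exp (-(x ⬝ᵥ (F *ᵥ x)) / 2)) =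
      ENNReal.ofReal (Real.sqrt ((2 * Real.pi) ^ Fintype.card ι / F.det)) := by
  obtain ⟨B, rfl, hB⟩ := hF.exists_eq_transpose_mul_self
  have hmap := Real.map_matrix_volume_pi_eq_smul_volume_pi hB
  have hf : Measurable fun x : ι → ℝ => ENNReal.ofReal (Real.exp (-(∑ i, x i ^ 2) / 2)) := by
    fun_prop
  have hlin : Measurable (toLin' B) := by
    have : Continuous (toLin' B) := LinearMap.continuous_of_finiteDimensional _
    exact this.measurable
  have h1 : ∀ x : ι → ℝ, ENNReal.ofReal (Real.exp (-(x ⬝ᵥ ((Bᵀ * B) *ᵥ x)) / 2)) =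
      ENNReal.ofReal (Real.exp (-(∑ i, (toLin' B x) i ^ 2) / 2)) := fun x => by
    rw [dotProduct_transpose_mul_self_mulVec, toLin'_apply]
  rw [lintegral_congr h1, ← lintegral_map hf hlin, hmap, lintegral_smul_measure,
    lintegral_exp_neg_sum_sq, smul_eq_mul, ← ENNReal.ofReal_mul (abs_nonneg _)]
  congr 1
  rw [det_mul, det_transpose, ← pow_two, Real.sqrt_div (by positivity), Real.sqrt_sq_eq_abs,
    abs_inv]
  ring

/-- The determinant is monotone in the Loewner order: a larger form has a smaller Gaussian
integral. -/
theorem PosDef.det_le_det {F G : Matrix ι ι ℝ} (hF : F.PosDef) (hG : G.PosDef)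
    (h : ∀ x, x ⬝ᵥ (F *ᵥ x) ≤ x ⬝ᵥ (G *ᵥ x)) : F.det ≤ G.det := by
  have hle : ∫⁻ x : ι → ℝ, ENNReal.ofReal (Real.exp (-(x ⬝ᵥ (G *ᵥ x)) / 2)) ≤
      ∫⁻ x : ι → ℝ, ENNReal.ofReal (Real.exp (-(x ⬝ᵥ (F *ᵥ x)) / 2)) :=
    lintegral_mono fun x => ENNReal.ofReal_le_ofReal (Real.exp_le_exp.2 (by linarith [h x]))
  have hFd := hF.det_pos
  have hGd := hG.det_pos
  rw [hF.lintegral_exp_neg, hG.lintegral_exp_neg,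
    ENNReal.ofReal_le_ofReal_iff (Real.sqrt_nonneg _),
    Real.sqrt_le_sqrt_iff (by positivity)] at hle
  rwa [div_le_div_iff_of_pos_left (by positivity) hGd hFd] at hle

theorem IsHermitian.mul_le_dotProduct {F : Matrix ι ι ℝ} (hF : F.IsHermitian) {c : ℝ}
    (hc : ∀ i, c ≤ hF.eigenvalues i) (x : ι → ℝ) : c * (x ⬝ᵥ x) ≤ x ⬝ᵥ (F *ᵥ x) := by
  have h : (F - c • (1 : Matrix ι ι ℝ)).PosSemidef := by
    have hU := mem_unitaryGroup_iff.1 hF.eigenvectorUnitary.2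
    have e : F - c • (1 : Matrix ι ι ℝ) = (hF.eigenvectorUnitary : Matrix ι ι ℝ) *
        diagonal (fun i => hF.eigenvalues i - c) *
          (hF.eigenvectorUnitary : Matrix ι ι ℝ)ᴴ := by
      have h1 : (diagonal fun i => hF.eigenvalues i - c) =
          diagonal hF.eigenvalues - c • (1 : Matrix ι ι ℝ) := by
        rw [← diagonal_one, ← diagonal_smul, diagonal_sub]; congr 1; ext; simp
      have h2 := hF.spectral_theorem
      rw [Unitary.conjStarAlgAut_apply] at h2
      conv_lhs => rw [h2]
      rw [h1, mul_sub, sub_mul, mul_smul_comm, smul_mul_assoc, mul_one, ← star_eq_conjTranspose,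
        hU]
      rfl
    rw [e]
    exact (PosSemidef.diagonal fun i => sub_nonneg.2 (hc i)).mul_mul_conjTranspose_same _
  have := h.dotProduct_mulVec_nonneg x
  rw [sub_mulVec, smul_mulVec, one_mulVec, dotProduct_sub, dotProduct_smul, smul_eq_mul,
    star_trivial] at this
  linarith

theorem IsHermitian.dotProduct_le_mul {F : Matrix ι ι ℝ} (hF : F.IsHermitian) {c : ℝ}
    (hc : ∀ i, hF.eigenvalues i ≤ c) (x : ι → ℝ) : x ⬝ᵥ (F *ᵥ x) ≤ c * (x ⬝ᵥ x) := by
  have h : (c • (1 : Matrix ι ι ℝ) - F).PosSemidef := by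
    have hU := mem_unitaryGroup_iff.1 hF.eigenvectorUnitary.2
    have e : c • (1 : Matrix ι ι ℝ) - F = (hF.eigenvectorUnitary : Matrix ι ι ℝ) *
        diagonal (fun i => c - hF.eigenvalues i) *
          (hF.eigenvectorUnitary : Matrix ι ι ℝ)ᴴ := by
      have h1 : (diagonal fun i => c - hF.eigenvalues i) =
          c • (1 : Matrix ι ι ℝ) - diagonal hF.eigenvalues := by
        rw [← diagonal_one, ← diagonal_smul, diagonal_sub]; congr 1; ext; simp
      have h2 := hF.spectral_theorem
      rw [Unitary.conjStarAlgAut_apply] at h2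
      conv_lhs => rw [h2]
      rw [h1, mul_sub, sub_mul, mul_smul_comm, smul_mul_assoc, mul_one, ← star_eq_conjTranspose,
        hU]
      rfl
    rw [e]
    exact (PosSemidef.diagonal fun i => sub_nonneg.2 (hc i)).mul_mul_conjTranspose_same _
  have := h.dotProduct_mulVec_nonneg x
  rw [sub_mulVec, smul_mulVec, one_mulVec, dotProduct_sub, dotProduct_smul, smul_eq_mul,
    star_trivial] at this
  linarith

end Matrix

namespace GLM

variable {n p : ℕ} {ι : Type*} [Fintype ι]

theorem dotProduct_fisher (M : ExpFamily) (Z : Matrix (Fin n) ι ℝ) (θ x : ι → ℝ) :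
    x ⬝ᵥ (fisher M Z θ *ᵥ x) = ∑ i, deriv (deriv M.b) ((Z *ᵥ θ) i) * (Z *ᵥ x) i ^ 2 := by
  rw [fisher, ← Matrix.mulVec_mulVec, ← Matrix.mulVec_mulVec, Matrix.dotProduct_mulVec,
    Matrix.vecMul_transpose, dotProduct]
  exact Finset.sum_congr rfl fun i _ => by rw [Matrix.mulVec_diagonal]; ring

theorem fisher_posSemidef (M : ExpFamily) (Z : Matrix (Fin n) ι ℝ) (θ : ι → ℝ) :
    (fisher M Z θ).PosSemidef :=
  Matrix.PosSemidef.of_dotProduct_mulVec_nonneg (fisher_isHermitian M Z θ) fun x => by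
    rw [star_trivial, dotProduct_fisher]
    exact Finset.sum_nonneg fun i _ => mul_nonneg (M.var_pos _).le (sq_nonneg _)

theorem fisher_posDef_of_injective (M : ExpFamily) {Z : Matrix (Fin n) ι ℝ}
    (h : Function.Injective fun x : ι → ℝ => Z *ᵥ x) (θ : ι → ℝ) : (fisher M Z θ).PosDef :=
  Matrix.PosDef.of_dotProduct_mulVec_pos (fisher_isHermitian M Z θ) fun x hx => by
    rw [star_trivial, dotProduct_fisher]
    have hz : Z *ᵥ x ≠ 0 := fun h0 => hx (h (by simpa using h0))
    obtain ⟨i, hi⟩ := Function.ne_iff.1 hz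
    refine Finset.sum_pos' (fun i _ => mul_nonneg (M.var_pos _).le (sq_nonneg _))
      ⟨i, Finset.mem_univ i, mul_pos (M.var_pos _) ?_⟩
    have hi' : (Z *ᵥ x) i ≠ 0 := hi
    positivity

variable [DecidableEq ι]

theorem fisher_posDef (M : ExpFamily) {Z : Matrix (Fin n) ι ℝ} {θ : ι → ℝ}
    (h : IsUnit (fisher M Z θ).det) : (fisher M Z θ).PosDef :=
  (fisher_posSemidef M Z θ).posDef_iff_det_ne_zero.2 h.ne_zero

/-- Nonsingularity of one Fisher information matrix is a property of the design only, as the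
variance function has no zeros. -/
theorem injective_mulVec_of_fisher (M : ExpFamily) {Z : Matrix (Fin n) ι ℝ} {θ : ι → ℝ}
    (h : IsUnit (fisher M Z θ).det) : Function.Injective fun x : ι → ℝ => Z *ᵥ x := by
  intro x x' hx
  by_contra hne
  have := (fisher_posDef M h).dotProduct_mulVec_pos (sub_ne_zero.2 hne)
  rw [star_trivial, dotProduct_fisher, Matrix.mulVec_sub, sub_eq_zero.2 hx] at this
  simp at this

/-- Whitening of the design: `Z = A B` with `F = Bᵀ B`, so that `A = Z F^{-1/2}` up to a rotation.
The columns of `A` are normalized in the variance weights, and its rows have the Mahalanobis norms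
of the rows of `Z`. -/
theorem exists_whitening (M : ExpFamily) {Z : Matrix (Fin n) ι ℝ} {θ : ι → ℝ}
    (h : IsUnit (fisher M Z θ).det) :
    ∃ (A : Matrix (Fin n) ι ℝ) (B : Matrix ι ι ℝ), Z = A * B ∧ fisher M Z θ = Bᵀ * B ∧
      (∀ j, ∑ i, deriv (deriv M.b) ((Z *ᵥ θ) i) * A i j ^ 2 = 1) ∧
      ∀ i, ∑ j, A i j ^ 2 = Z i ⬝ᵥ ((fisher M Z θ)⁻¹ *ᵥ Z i) := by
  obtain ⟨B, hF, hB⟩ := (fisher_posDef M h).exists_eq_transpose_mul_self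
  have hBu : IsUnit B.det := isUnit_iff_ne_zero.2 hB
  refine ⟨Z * B⁻¹, B, ?_, hF, fun j => ?_, fun i => ?_⟩
  · rw [Matrix.mul_assoc, Matrix.nonsing_inv_mul _ hBu, Matrix.mul_one]
  · have h1 := dotProduct_fisher M Z θ (B⁻¹ *ᵥ Pi.single j 1)
    have h2 : (B⁻¹ *ᵥ Pi.single j 1) ⬝ᵥ (fisher M Z θ *ᵥ (B⁻¹ *ᵥ Pi.single j 1)) = 1 := by
      rw [hF, Matrix.dotProduct_transpose_mul_self_mulVec, Matrix.mulVec_mulVec,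
        Matrix.mul_nonsing_inv _ hBu, Matrix.one_mulVec]
      simp [Pi.single_apply]
    rw [h2] at h1
    rw [h1]
    refine Finset.sum_congr rfl fun i _ => ?_
    rw [Matrix.mulVec_mulVec]
    simp
  · have hinv : (fisher M Z θ)⁻¹ = B⁻¹ * (B⁻¹)ᵀ := by
      rw [hF, Matrix.mul_inv_rev, Matrix.transpose_nonsing_inv]
    rw [hinv, ← Matrix.mulVec_mulVec, Matrix.dotProduct_mulVec, Matrix.mulVec_transpose,
      dotProduct]
    refine Finset.sum_congr rfl fun j _ => ?_
    rw [pow_two]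
    rfl

/-! ### Gaussian densities -/

/-- The normal density with a positive definite precision matrix. -/
theorem normalDensity_inv (m : ι → ℝ) {G : Matrix ι ι ℝ} (hG : G.PosDef) (x : ι → ℝ) :
    normalDensity m G⁻¹ x = Real.sqrt (G.det / (2 * Real.pi) ^ Fintype.card ι) *
      Real.exp (-((x - m) ⬝ᵥ (G *ᵥ (x - m))) / 2) := by
  have hu : IsUnit G.det := isUnit_iff_ne_zero.2 hG.det_pos.ne'
  rw [normalDensity, Matrix.nonsing_inv_nonsing_inv _ hu, Matrix.det_nonsing_inv,
    Ring.inverse_eq_inv', ← Real.sqrt_inv, mul_inv, inv_inv]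
  congr 2
  ring

theorem lintegral_normalDensity_inv (m : ι → ℝ) {G : Matrix ι ι ℝ} (hG : G.PosDef) :
    ∫⁻ x, ENNReal.ofReal (normalDensity m G⁻¹ x) = 1 := by
  have hd := hG.det_pos
  simp_rw [normalDensity_inv m hG, ENNReal.ofReal_mul (Real.sqrt_nonneg _)]
  rw [lintegral_const_mul' _ _ ENNReal.ofReal_ne_top,
    lintegral_sub_right_eq_self (μ := volume)
      (fun x => ENNReal.ofReal (Real.exp (-(x ⬝ᵥ (G *ᵥ x)) / 2))) m,
    hG.lintegral_exp_neg, ← ENNReal.ofReal_mul (Real.sqrt_nonneg _),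
    ← Real.sqrt_mul (by positivity)]
  rw [div_mul_div_cancel₀ (by positivity), div_self hd.ne']
  simp

end GLM

/-! ### The maximum likelihood estimator and measurability of the posterior -/

namespace GLM

variable {n p : ℕ}

section MLE

variable {ι : Type*} [Fintype ι]

/-- The mean-value map `θ ↦ Zᵀ b'(Z θ)`, whose value at the maximum likelihood estimator is the
sufficient statistic `Zᵀ y`. -/
noncomputable def meanMap (M : ExpFamily) (Z : Matrix (Fin n) ι ℝ) (θ : ι → ℝ) : ι → ℝ :=
  Zᵀ *ᵥ fun i => deriv M.b ((Z *ᵥ θ) i)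

theorem transpose_mulVec_dotProduct (Z : Matrix (Fin n) ι ℝ) (v : Fin n → ℝ) (x : ι → ℝ) :
    (Zᵀ *ᵥ v) ⬝ᵥ x = ∑ i, v i * (Z *ᵥ x) i := by
  rw [Matrix.mulVec_transpose, ← Matrix.dotProduct_mulVec, dotProduct]

theorem hasDerivAt_logLik (M : ExpFamily) (Z : Matrix (Fin n) ι ℝ) (y : Fin n → ℝ) (θ v : ι → ℝ) :
    HasDerivAt (fun t : ℝ => logLik M Z y (θ + t • v))
      ((Zᵀ *ᵥ y - meanMap M Z θ) ⬝ᵥ v) 0 := by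
  have h : ∀ i, HasDerivAt (fun t : ℝ => y i * (Z *ᵥ (θ + t • v)) i - M.b ((Z *ᵥ (θ + t • v)) i) +
      M.k (y i)) (y i * (Z *ᵥ v) i - deriv M.b ((Z *ᵥ θ) i) * (Z *ᵥ v) i) 0 := fun i => by
    have hl : HasDerivAt (fun t : ℝ => (Z *ᵥ (θ + t • v)) i) ((Z *ᵥ v) i) 0 := by
      have : (fun t : ℝ => (Z *ᵥ (θ + t • v)) i) = fun t => (Z *ᵥ θ) i + t * (Z *ᵥ v) i := by
        funext t; simp [Matrix.mulVec_add, Matrix.mulVec_smul]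
      rw [this]
      simpa using ((hasDerivAt_id (0 : ℝ)).mul_const ((Z *ᵥ v) i)).const_add ((Z *ᵥ θ) i)
    have hb : HasDerivAt M.b (deriv M.b ((Z *ᵥ θ) i)) ((Z *ᵥ (θ + (0 : ℝ) • v)) i) := by
      simpa using (M.differentiable_b ((Z *ᵥ θ) i)).hasDerivAt
    exact ((hl.const_mul (y i)).sub (hb.comp (0 : ℝ) hl)).add_const _
  refine (HasDerivAt.fun_sum fun i (_ : i ∈ Finset.univ) => h i).congr_deriv ?_
  rw [meanMap, ← Matrix.mulVec_sub, transpose_mulVec_dotProduct]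
  exact Finset.sum_congr rfl fun i _ => by simp only [Pi.sub_apply]; ring

/-- The likelihood equation. -/
theorem isMLE_iff (M : ExpFamily) (Z : Matrix (Fin n) ι ℝ) (y : Fin n → ℝ) (θ : ι → ℝ) :
    IsMLE M Z y θ ↔ meanMap M Z θ = Zᵀ *ᵥ y := by
  constructor
  · intro h
    have hz : ∀ v, (Zᵀ *ᵥ y - meanMap M Z θ) ⬝ᵥ v = 0 := fun v => by
      refine IsLocalMax.hasDerivAt_eq_zero (Eventually.of_forall fun t => ?_)
        (hasDerivAt_logLik M Z y θ v)
      simpa using h (θ + t • v)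
    exact (sub_eq_zero.1 (dotProduct_self_eq_zero.1 (hz _))).symm
  · intro h θ'
    have hz : (Zᵀ *ᵥ y - meanMap M Z θ) ⬝ᵥ (θ' - θ) = 0 := by rw [h]; simp
    rw [meanMap, ← Matrix.mulVec_sub, transpose_mulVec_dotProduct] at hz
    rw [← sub_nonpos, logLik, logLik, ← Finset.sum_sub_distrib, ← hz]
    refine Finset.sum_le_sum fun i _ => ?_
    have := M.tangent_le ((Z *ᵥ θ) i) ((Z *ᵥ θ') i)
    simp only [Pi.sub_apply, Matrix.mulVec_sub]
    linarith

theorem continuous_meanMap (M : ExpFamily) (Z : Matrix (Fin n) ι ℝ) :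
    Continuous (meanMap M Z) := by
  have hb := M.continuous_deriv_b
  unfold meanMap
  fun_prop

theorem injective_meanMap (M : ExpFamily) {Z : Matrix (Fin n) ι ℝ}
    (hZ : Function.Injective fun x : ι → ℝ => Z *ᵥ x) : Function.Injective (meanMap M Z) := by
  intro θ θ' h
  apply hZ
  have h0 : (meanMap M Z θ - meanMap M Z θ') ⬝ᵥ (θ - θ') = 0 := by rw [h]; simp
  rw [meanMap, meanMap, ← Matrix.mulVec_sub, transpose_mulVec_dotProduct] at h0
  have hterm : ∀ i, 0 ≤ ((fun i => deriv M.b ((Z *ᵥ θ) i)) - fun i => deriv M.b ((Z *ᵥ θ') i)) i *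
      (Z *ᵥ (θ - θ')) i := fun i => by
    simp only [Pi.sub_apply, Matrix.mulVec_sub]
    rcases le_total ((Z *ᵥ θ) i) ((Z *ᵥ θ') i) with hle | hle
    · exact mul_nonneg_of_nonpos_of_nonpos
        (sub_nonpos.2 (M.strictMono_deriv_b.monotone hle)) (sub_nonpos.2 hle)
    · exact mul_nonneg (sub_nonneg.2 (M.strictMono_deriv_b.monotone hle)) (sub_nonneg.2 hle)
  rw [Finset.sum_eq_zero_iff_of_nonneg fun i _ => hterm i] at h0
  funext i
  have hi := h0 i (Finset.mem_univ i)
  simp only [Pi.sub_apply, Matrix.mulVec_sub, mul_eq_zero, sub_eq_zero] at hi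
  exact hi.elim (fun hi => M.strictMono_deriv_b.injective hi) id

theorem isMLE_mle (M : ExpFamily) {Z : Matrix (Fin n) ι ℝ} {y : Fin n → ℝ}
    (h : ∃ θ, IsMLE M Z y θ) : IsMLE M Z y (mle M Z y) := by
  rw [mle, dif_pos h]; exact h.choose_spec

theorem mle_eq_extend (M : ExpFamily) {Z : Matrix (Fin n) ι ℝ}
    (hZ : Function.Injective fun x : ι → ℝ => Z *ᵥ x) (y : Fin n → ℝ) :
    mle M Z y = Function.extend (meanMap M Z) id 0 (Zᵀ *ᵥ y) := by
  by_cases h : ∃ θ, IsMLE M Z y θ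
  · rw [← (isMLE_iff M Z y _).1 (isMLE_mle M h), (injective_meanMap M hZ).extend_apply]; rfl
  · rw [mle, dif_neg h, Function.extend_apply']
    · rfl
    · rintro ⟨θ, hθ⟩
      exact h ⟨θ, (isMLE_iff M Z y θ).2 hθ⟩

/-- For a design of full column rank the estimator is measurable: it is a left inverse of a
continuous injective map, which is a measurable embedding by the Lusin-Souslin theorem. -/
theorem measurable_mle (M : ExpFamily) {Z : Matrix (Fin n) ι ℝ}
    (hZ : Function.Injective fun x : ι → ℝ => Z *ᵥ x) : Measurable (mle M Z) := by
  have he := (continuous_meanMap M Z).measurableEmbedding (injective_meanMap M hZ)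
  have h1 : Measurable (Function.extend (meanMap M Z) id (0 : (ι → ℝ) → ι → ℝ)) :=
    he.measurable_extend measurable_id measurable_const
  have h2 : Measurable fun y : Fin n → ℝ => Zᵀ *ᵥ y := by
    have : Continuous fun y : Fin n → ℝ => Zᵀ *ᵥ y := by fun_prop
    exact this.measurable
  rw [show mle M Z = fun y => _ from funext (mle_eq_extend M hZ)]
  exact h1.comp h2

theorem continuous_fisher (M : ExpFamily) (Z : Matrix (Fin n) ι ℝ) :
    Continuous (fisher M Z) := by
  have hb := M.continuous_var
  unfold fisher
  fun_prop

theorem measurable_normalDensity [DecidableEq ι] (m : ι → ℝ) (C : Matrix ι ι ℝ) :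
    Measurable (normalDensity m C) := by
  have : Continuous (normalDensity m C) := by unfold normalDensity; fun_prop
  exact this.measurable

end MLE

variable (M : ExpFamily) (X : Matrix (Fin n) (Fin p) ℝ)

theorem slab_eq {lam : ℝ} (hlam : 0 < lam) (S : Finset (Fin p))
    (hS : Function.Injective fun x : S → ℝ => cols X S *ᵥ x) (y : Fin n → ℝ) (θ : S → ℝ) :
    slab M X lam y S θ =
      Real.sqrt ((lam • fisher M (cols X S) (mle M (cols X S) y)).det /
        (2 * Real.pi) ^ Fintype.card S) *
      Real.exp (-((θ - mle M (cols X S) y) ⬝ᵥ ((lam • fisher M (cols X S) (mle M (cols X S) y)) *ᵥ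
        (θ - mle M (cols X S) y))) / 2) :=
  normalDensity_inv _ ((fisher_posDef_of_injective M hS _).smul hlam) _

theorem measurable_slab_uncurry {lam : ℝ} (hlam : 0 < lam) (S : Finset (Fin p))
    (hS : Function.Injective fun x : S → ℝ => cols X S *ᵥ x) :
    Measurable fun q : (Fin n → ℝ) × (S → ℝ) => slab M X lam q.1 S q.2 := by
  have hf := continuous_fisher M (cols X S)
  have hc : Continuous fun q : (S → ℝ) × (S → ℝ) =>
      Real.sqrt ((lam • fisher M (cols X S) q.1).det / (2 * Real.pi) ^ Fintype.card S) *
      Real.exp (-((q.2 - q.1) ⬝ᵥ ((lam • fisher M (cols X S) q.1) *ᵥ (q.2 - q.1))) / 2) := by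
    fun_prop
  have hm : Measurable fun q : (Fin n → ℝ) × (S → ℝ) => (mle M (cols X S) q.1, q.2) :=
    ((measurable_mle M hS).comp measurable_fst).prodMk measurable_snd
  have h := hc.measurable.comp hm
  simp only [Function.comp_def] at h
  rwa [show (fun q : (Fin n → ℝ) × (S → ℝ) => slab M X lam q.1 S q.2) = fun q => _ from
    funext fun q => slab_eq M X hlam S hS q.1 q.2]

theorem measurable_slab (lam : ℝ) (y : Fin n → ℝ) (S : Finset (Fin p)) :
    Measurable (slab M X lam y S) := measurable_normalDensity _ _

theorem measurable_extend (S : Finset (Fin p)) : Measurable (extend S) := by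
  refine measurable_pi_iff.2 fun j => ?_
  by_cases h : j ∈ S
  · simp only [extend, h, dite_true]; exact measurable_pi_apply _
  · simp only [extend, h, dite_false]; exact measurable_const

theorem lintegral_prior (w : ℕ → ℝ) (lam : ℝ) (y : Fin n → ℝ) {g : (Fin p → ℝ) → ℝ≥0∞}
    (hg : Measurable g) :
    ∫⁻ θ, g θ ∂(prior M X w lam y) = ∑ S : Finset (Fin p),
      ENNReal.ofReal (w S.card / (p.choose S.card : ℝ)) *
        ∫⁻ θ, ENNReal.ofReal (slab M X lam y S θ) * g (extend S θ) := by
  rw [prior, lintegral_finsetSum_measure]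
  refine Finset.sum_congr rfl fun S _ => ?_
  rw [lintegral_smul_measure, lintegral_map hg (measurable_extend S),
    lintegral_withDensity_eq_lintegral_mul _ (measurable_slab M X lam y S).ennreal_ofReal
      (g := fun θ => g (extend S θ)) (hg.comp (measurable_extend S))]
  rfl

theorem measurable_logLik_uncurry {ι : Type*} [Fintype ι] (Z : Matrix (Fin n) ι ℝ) :
    Measurable fun q : (Fin n → ℝ) × (ι → ℝ) => logLik M Z q.1 q.2 := by
  have hb := M.continuous_b.measurable
  have hk := M.measurable_k
  have hz : ∀ i, Measurable fun q : (Fin n → ℝ) × (ι → ℝ) => (Z *ᵥ q.2) i := fun i => by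
    have : Continuous fun q : (Fin n → ℝ) × (ι → ℝ) => (Z *ᵥ q.2) i := by fun_prop
    exact this.measurable
  unfold logLik
  exact Finset.measurable_sum _ fun i _ =>
    ((((measurable_pi_apply i).comp measurable_fst).mul (hz i)).sub (hb.comp (hz i))).add
      (hk.comp ((measurable_pi_apply i).comp measurable_fst))

theorem measurableSet_card_supp (K : ℝ) :
    MeasurableSet {θ : Fin p → ℝ | K < ((supp θ).card : ℝ)} := by
  have : Measurable fun θ : Fin p → ℝ => ((supp θ).card : ℝ) := by
    have : (fun θ : Fin p → ℝ => ((supp θ).card : ℝ)) =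
        fun θ => ∑ j, if θ j ≠ 0 then (1 : ℝ) else 0 := by
      funext θ; rw [supp, Finset.card_filter]; push_cast; rfl
    rw [this]
    refine Finset.measurable_sum _ fun j _ => Measurable.ite ?_ measurable_const measurable_const
    exact (measurableSet_singleton (0 : ℝ)).compl.preimage (measurable_pi_apply j)
  exact this measurableSet_Ioi

/-- The unnormalized posterior mass of `A`, as a sum over models. -/
theorem setLIntegral_prior (w : ℕ → ℝ) (lam α : ℝ) (y : Fin n → ℝ) {A : Set (Fin p → ℝ)}
    (hA : MeasurableSet A) :
    ∫⁻ θ in A, ENNReal.ofReal (Real.exp (α * logLik M X y θ)) ∂(prior M X w lam y) =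
      ∑ S : Finset (Fin p), ENNReal.ofReal (w S.card / (p.choose S.card : ℝ)) *
        ∫⁻ θ, ENNReal.ofReal (slab M X lam y S θ) * (extend S ⁻¹' A).indicator
          (fun θ => ENNReal.ofReal (Real.exp (α * logLik M (cols X S) y θ))) θ := by
  have hm : Measurable fun θ => ENNReal.ofReal (Real.exp (α * logLik M X y θ)) := by
    have := (measurable_logLik_uncurry M X).comp (measurable_prodMk_left (x := y))
    exact (Real.measurable_exp.comp (this.const_mul α)).ennreal_ofReal
  rw [← lintegral_indicator hA, lintegral_prior M X w lam y (hm.indicator hA)]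
  refine Finset.sum_congr rfl fun S _ => ?_
  congr 1
  refine lintegral_congr fun θ => ?_
  congr 1
  by_cases h : extend S θ ∈ A
  · rw [Set.indicator_of_mem h, Set.indicator_of_mem (by exact h), logLik_extend]
  · rw [Set.indicator_of_notMem h, Set.indicator_of_notMem (by exact h)]

theorem measurable_setLIntegral_prior {w : ℕ → ℝ} {lam : ℝ} (hlam : 0 < lam) (α : ℝ)
    (hX : ∀ S : Finset (Fin p), w S.card ≠ 0 →
      Function.Injective fun x : S → ℝ => cols X S *ᵥ x)
    {A : Set (Fin p → ℝ)} (hA : MeasurableSet A) :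
    Measurable fun y =>
      ∫⁻ θ in A, ENNReal.ofReal (Real.exp (α * logLik M X y θ)) ∂(prior M X w lam y) := by
  simp_rw [setLIntegral_prior M X w lam α _ hA]
  refine Finset.measurable_sum _ fun S _ => ?_
  by_cases hS : w S.card = 0
  · simp [hS]
  · refine Measurable.const_mul ?_ _
    refine Measurable.lintegral_prod_right ?_
    refine (measurable_slab_uncurry M X hlam S (hX S hS)).ennreal_ofReal.mul ?_
    have h1 : Measurable fun q : (Fin n → ℝ) × (S → ℝ) =>
        ENNReal.ofReal (Real.exp (α * logLik M (cols X S) q.1 q.2)) :=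
      (Real.measurable_exp.comp
        ((measurable_logLik_uncurry M (cols X S)).const_mul α)).ennreal_ofReal
    exact h1.indicator ((measurable_extend S hA).preimage measurable_snd)

theorem measurable_posterior {w : ℕ → ℝ} {lam : ℝ} (hlam : 0 < lam) (α : ℝ)
    (hX : ∀ S : Finset (Fin p), w S.card ≠ 0 →
      Function.Injective fun x : S → ℝ => cols X S *ᵥ x)
    {A : Set (Fin p → ℝ)} (hA : MeasurableSet A) :
    Measurable fun y => posterior M X w lam α y A := by
  refine (measurable_setLIntegral_prior M X hlam α hX hA).div ?_
  simpa using measurable_setLIntegral_prior M X hlam α hX MeasurableSet.univ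

theorem posterior_le_one (w : ℕ → ℝ) (lam α : ℝ) (y : Fin n → ℝ) (A : Set (Fin p → ℝ)) :
    posterior M X w lam α y A ≤ 1 :=
  ENNReal.div_le_of_le_mul (by rw [one_mul]; exact setLIntegral_le_lintegral _ _)

theorem supp_extend_subset (S : Finset (Fin p)) (θ : S → ℝ) : supp (extend S θ) ⊆ S := by
  intro j hj
  by_contra h
  simp [supp, extend, h] at hj

end GLM

/-! ### The numerator: replacing the data-dependent slab by a deterministic density -/

namespace GLM

section

variable {ι : Type*} [Fintype ι]

theorem quadForm_le_of_posSemidef {F G : Matrix ι ι ℝ} (h : (G - F).PosSemidef) (x : ι → ℝ) :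
    x ⬝ᵥ (F *ᵥ x) ≤ x ⬝ᵥ (G *ᵥ x) := by
  have := h.dotProduct_mulVec_nonneg x
  rw [star_trivial, Matrix.sub_mulVec, dotProduct_sub] at this
  linarith

theorem quadForm_smul (c : ℝ) (F : Matrix ι ι ℝ) (x : ι → ℝ) :
    x ⬝ᵥ ((c • F) *ᵥ x) = c * (x ⬝ᵥ (F *ᵥ x)) := by
  rw [Matrix.smul_mulVec, dotProduct_smul, smul_eq_mul]

variable [DecidableEq ι]

theorem quadForm_add_le {F : Matrix ι ι ℝ} (hF : F.PosDef) (u v : ι → ℝ) :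
    (u + v) ⬝ᵥ (F *ᵥ (u + v)) ≤ 2 * (u ⬝ᵥ (F *ᵥ u)) + 2 * (v ⬝ᵥ (F *ᵥ v)) := by
  obtain ⟨B, rfl, -⟩ := hF.exists_eq_transpose_mul_self
  simp only [Matrix.dotProduct_transpose_mul_self_mulVec, Finset.mul_sum]
  rw [← Finset.sum_add_distrib]
  refine Finset.sum_le_sum fun i _ => ?_
  rw [Matrix.mulVec_add, Pi.add_apply]
  nlinarith [sq_nonneg ((B *ᵥ u) i - (B *ᵥ v) i)]

/-- Two normal densities with comparable precision matrices and close centres. Inflating the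
covariance by the factor `2 D` absorbs both the comparison factor and the distance of the
centres. -/
theorem normalDensity_le {F G : Matrix ι ι ℝ} (hF : F.PosDef) (hG : G.PosDef) {D lam c : ℝ}
    (hD : 0 < D) (hlam : 0 < lam) (h1 : (F - D⁻¹ • G).PosSemidef) (h2 : (D • G - F).PosSemidef)
    {m m' : ι → ℝ} (h3 : (m - m') ⬝ᵥ (G *ᵥ (m - m')) ≤ D * c) (x : ι → ℝ) :
    normalDensity m (lam • F)⁻¹ x ≤ Real.exp (lam * c / 2) * (Real.sqrt 2 * D) ^ Fintype.card ι *
      normalDensity m' ((lam / (2 * D)) • G)⁻¹ x := by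
  rw [normalDensity_inv m (hF.smul hlam), normalDensity_inv m' (hG.smul (by positivity))]
  have hdet : (lam • F).det ≤ (2 * D ^ 2) ^ Fintype.card ι * ((lam / (2 * D)) • G).det := by
    refine ((hF.smul hlam).det_le_det (hG.smul (mul_pos hlam hD)) fun x => ?_).trans_eq ?_
    · have := quadForm_le_of_posSemidef h2 x
      rw [quadForm_smul] at this
      rw [quadForm_smul, quadForm_smul, mul_assoc]
      exact mul_le_mul_of_nonneg_left this hlam.le
    · rw [Matrix.det_smul, Matrix.det_smul, ← mul_assoc, ← mul_pow]
      congr 2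
      field_simp
  have hsqrt : Real.sqrt ((lam • F).det / (2 * Real.pi) ^ Fintype.card ι) ≤
      (Real.sqrt 2 * D) ^ Fintype.card ι *
        Real.sqrt (((lam / (2 * D)) • G).det / (2 * Real.pi) ^ Fintype.card ι) := by
    have hpos : 0 ≤ (Real.sqrt 2 * D) ^ Fintype.card ι := by positivity
    have hsq : ((Real.sqrt 2 * D) ^ Fintype.card ι) ^ 2 = (2 * D ^ 2) ^ Fintype.card ι := by
      rw [← pow_mul, mul_comm (Fintype.card ι) 2, pow_mul, mul_pow, Real.sq_sqrt zero_le_two]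
    rw [← Real.sqrt_sq hpos, ← Real.sqrt_mul (sq_nonneg _)]
    refine Real.sqrt_le_sqrt ?_
    rw [hsq, ← mul_div_assoc]
    gcongr
  have hexp : -((x - m) ⬝ᵥ ((lam • F) *ᵥ (x - m))) / 2 ≤
      lam * c / 2 + -((x - m') ⬝ᵥ (((lam / (2 * D)) • G) *ᵥ (x - m'))) / 2 := by
    have e1 := quadForm_le_of_posSemidef h1 (x - m)
    have e2 := quadForm_add_le hG (x - m) (m - m')
    rw [quadForm_smul] at e1 ⊢
    rw [quadForm_smul]
    rw [sub_add_sub_cancel] at e2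
    set q := (x - m) ⬝ᵥ (G *ᵥ (x - m))
    set q' := (x - m') ⬝ᵥ (G *ᵥ (x - m'))
    have e3 : D⁻¹ * (q' / 2 - D * c) ≤ (x - m) ⬝ᵥ (F *ᵥ (x - m)) :=
      (mul_le_mul_of_nonneg_left (by linarith) (inv_pos.2 hD).le).trans e1
    have e4 : D⁻¹ * (q' / 2 - D * c) = q' / (2 * D) - c := by field_simp
    rw [e4] at e3
    have := mul_le_mul_of_nonneg_left e3 hlam.le
    have e5 : lam / (2 * D) * q' = lam * (q' / (2 * D)) := by ring
    rw [e5]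
    linarith
  calc _ ≤ ((Real.sqrt 2 * D) ^ Fintype.card ι *
        Real.sqrt (((lam / (2 * D)) • G).det / (2 * Real.pi) ^ Fintype.card ι)) *
        Real.exp (lam * c / 2 + -((x - m') ⬝ᵥ (((lam / (2 * D)) • G) *ᵥ (x - m'))) / 2) :=
        mul_le_mul hsqrt (Real.exp_le_exp.2 hexp) (Real.exp_pos _).le (by positivity)
    _ = _ := by rw [Real.exp_add]; ring

end

variable {n p : ℕ} (M : ExpFamily) (X : Matrix (Fin n) (Fin p) ℝ)

/-- Mixture over models of fractional likelihood ratios averaged over the densities `g S`. -/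
noncomputable def mixture (θ₀ : Fin p → ℝ) (α : ℝ) (coef : Finset (Fin p) → ℝ)
    (g : ∀ S : Finset (Fin p), (S → ℝ) → ℝ) (y : Fin n → ℝ) : ℝ≥0∞ :=
  ∑ S, ENNReal.ofReal (coef S) * ∫⁻ θ, ENNReal.ofReal (g S θ) *
    ENNReal.ofReal (Real.exp (α * (logLik M (cols X S) y θ - logLik M X y θ₀)))

theorem measurable_mixture_integrand (θ₀ : Fin p → ℝ) (α : ℝ)
    {S : Finset (Fin p)} {g : (S → ℝ) → ℝ} (hg : Measurable g) :
    Measurable fun q : (Fin n → ℝ) × (S → ℝ) => ENNReal.ofReal (g q.2) *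
      ENNReal.ofReal (Real.exp (α * (logLik M (cols X S) q.1 q.2 - logLik M X q.1 θ₀))) := by
  have h1 := measurable_logLik_uncurry M (cols X S)
  have h2 : Measurable fun q : (Fin n → ℝ) × (S → ℝ) => logLik M X q.1 θ₀ :=
    (measurable_logLik_uncurry M X).comp (measurable_fst.prodMk measurable_const)
  exact (hg.comp measurable_snd).ennreal_ofReal.mul
    (Real.measurable_exp.comp ((h1.sub h2).const_mul α)).ennreal_ofReal

theorem measurable_mixture (θ₀ : Fin p → ℝ) (α : ℝ) (coef : Finset (Fin p) → ℝ)
    {g : ∀ S : Finset (Fin p), (S → ℝ) → ℝ} (hg : ∀ S, Measurable (g S)) :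
    Measurable (mixture M X θ₀ α coef g) :=
  Finset.measurable_sum _ fun S _ => Measurable.const_mul
    (measurable_mixture_integrand M X θ₀ α (hg S)).lintegral_prod_right _

theorem lintegral_mixture_le (θ₀ : Fin p → ℝ) {α : ℝ} (h0 : 0 ≤ α) (h1 : α ≤ 1)
    {coef : Finset (Fin p) → ℝ} (hc : ∀ S, 0 ≤ coef S)
    {g : ∀ S : Finset (Fin p), (S → ℝ) → ℝ} (hg : ∀ S, Measurable (g S))
    (hg1 : ∀ S, coef S ≠ 0 → ∫⁻ θ, ENNReal.ofReal (g S θ) = 1) :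
    ∫⁻ y, mixture M X θ₀ α coef g y ∂(jointLaw M X θ₀) ≤ ENNReal.ofReal (∑ S, coef S) := by
  unfold mixture
  rw [lintegral_finsetSum _ fun S _ => Measurable.const_mul
    (measurable_mixture_integrand M X θ₀ α (hg S)).lintegral_prod_right _,
    ENNReal.ofReal_sum_of_nonneg fun S _ => hc S]
  refine Finset.sum_le_sum fun S _ => ?_
  by_cases hS : coef S = 0
  · simp [hS]
  have hm := measurable_mixture_integrand M X θ₀ α (hg S)
  rw [lintegral_const_mul _ hm.lintegral_prod_right]
  refine mul_le_of_le_one_right' ?_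
  rw [lintegral_lintegral_swap hm.aemeasurable]
  calc _ ≤ ∫⁻ θ, ENNReal.ofReal (g S θ) := lintegral_mono fun θ => by
        rw [lintegral_const_mul' _ _ ENNReal.ofReal_ne_top]
        exact mul_le_of_le_one_right' (lintegral_exp_logLik_le M X (cols X S) θ θ₀ h0 h1)
    _ ≤ 1 := (hg1 S hS).le

/-- The prior weight of the model `S`, inflated by the cost of a deterministic slab, for models of
size larger than `κ`. -/
noncomputable def inflatedWeight (w : ℕ → ℝ) (lam D κ : ℝ) (S : Finset (Fin p)) : ℝ :=
  if κ < (S.card : ℝ) then w S.card / (p.choose S.card : ℝ) *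
    (Real.exp (lam * (S.card * Real.log p) / 2) * (Real.sqrt 2 * D) ^ S.card) else 0

theorem setLIntegral_prior_le_mixture (θ₀ : Fin p → ℝ) {w : ℕ → ℝ} (hw : ∀ s, 0 ≤ w s)
    {lam α D : ℝ} (hD : 0 < D) (hlam : 0 < lam) (κ : ℝ) (y : Fin n → ℝ)
    (θbar : ∀ S : Finset (Fin p), S → ℝ)
    (hns : ∀ S : Finset (Fin p), w S.card ≠ 0 → IsUnit (fisher M (cols X S) (θbar S)).det)
    (h1 : ∀ S : Finset (Fin p), w S.card ≠ 0 → (fisher M (cols X S) (mle M (cols X S) y) -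
      D⁻¹ • fisher M (cols X S) (θbar S)).PosSemidef)
    (h2 : ∀ S : Finset (Fin p), w S.card ≠ 0 → (D • fisher M (cols X S) (θbar S) -
      fisher M (cols X S) (mle M (cols X S) y)).PosSemidef)
    (h3 : ∀ S : Finset (Fin p), w S.card ≠ 0 → (mle M (cols X S) y - θbar S) ⬝ᵥ
      (fisher M (cols X S) (θbar S) *ᵥ (mle M (cols X S) y - θbar S)) ≤
        D * (S.card : ℝ) * Real.log p) :
    ∫⁻ θ in {θ | κ < ((supp θ).card : ℝ)}, ENNReal.ofReal (Real.exp (α * logLik M X y θ))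
        ∂(prior M X w lam y) ≤
      ENNReal.ofReal (Real.exp (α * logLik M X y θ₀)) *
        mixture M X θ₀ α (inflatedWeight w lam D κ)
          (fun S => normalDensity (θbar S) ((lam / (2 * D)) • fisher M (cols X S) (θbar S))⁻¹)
          y := by
  rw [setLIntegral_prior M X w lam α y (measurableSet_card_supp κ), mixture, Finset.mul_sum]
  refine Finset.sum_le_sum fun S _ => ?_
  by_cases hS : w S.card = 0
  · simp [hS]
  by_cases hκ : κ < (S.card : ℝ)
  swap
  · have hempty : extend S ⁻¹' {θ | κ < ((supp θ).card : ℝ)} = ∅ := by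
      refine Set.eq_empty_of_forall_notMem fun θ hθ => hκ (lt_of_lt_of_le hθ ?_)
      exact_mod_cast Finset.card_le_card (supp_extend_subset S θ)
    simp [hempty]
  have hG := fisher_posDef M (hns S hS)
  have hF := fisher_posDef_of_injective M (injective_mulVec_of_fisher M (hns S hS))
    (mle M (cols X S) y)
  have hden := normalDensity_le hF hG hD hlam (h1 S hS) (h2 S hS)
    ((h3 S hS).trans_eq (mul_assoc _ _ _))
  rw [Fintype.card_coe] at hden
  rw [inflatedWeight, if_pos hκ,
    ENNReal.ofReal_mul (div_nonneg (hw _) (Nat.cast_nonneg _)), mul_left_comm, mul_assoc]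
  refine mul_le_mul_right ?_ _
  rw [mul_left_comm, ← lintegral_const_mul' _ _ ENNReal.ofReal_ne_top,
    ← lintegral_const_mul' _ _ ENNReal.ofReal_ne_top]
  refine lintegral_mono fun θ => ?_
  have hexp : Real.exp (α * logLik M (cols X S) y θ) = Real.exp (α * logLik M X y θ₀) *
      Real.exp (α * (logLik M (cols X S) y θ - logLik M X y θ₀)) := by
    rw [← Real.exp_add]; congr 1; ring
  refine (mul_le_mul_right (Set.indicator_le_self _ _ _) _).trans ?_
  calc ENNReal.ofReal (slab M X lam y S θ) *
        ENNReal.ofReal (Real.exp (α * logLik M (cols X S) y θ))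
      ≤ ENNReal.ofReal (Real.exp (lam * (S.card * Real.log p) / 2) *
          (Real.sqrt 2 * D) ^ S.card * normalDensity (θbar S)
            ((lam / (2 * D)) • fisher M (cols X S) (θbar S))⁻¹ θ) *
        ENNReal.ofReal (Real.exp (α * logLik M (cols X S) y θ)) :=
        mul_le_mul_left (ENNReal.ofReal_le_ofReal (hden θ)) _
    _ = _ := by
        have hc : 0 ≤ Real.exp (lam * (S.card * Real.log p) / 2) * (Real.sqrt 2 * D) ^ S.card := by
          positivity
        rw [hexp, ENNReal.ofReal_mul hc, ENNReal.ofReal_mul (Real.exp_pos (α * _)).le]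
        ring

end GLM

/-! ### The denominator: a lower bound from the true model -/

namespace GLM

section

variable {n p : ℕ} {ι : Type*} [Fintype ι]

/-- If the whitened score at `θ` is small compared with the inverse leverage, the linear predictor
of the maximum likelihood estimator is uniformly close to that of `θ`. By concavity it suffices to
look at a point of the segment from `θ` to the estimator at which the predictors differ by at most
`1/2`; there the likelihood ratio is bounded above by a concave quadratic. -/
theorem abs_mulVec_sub_le (M : ExpFamily) {Z : Matrix (Fin n) ι ℝ} {y : Fin n → ℝ}
    {m θ : ι → ℝ} (hm : IsMLE M Z y m) {A : Matrix (Fin n) ι ℝ} {B : Matrix ι ι ℝ}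
    (hZ : Z = A * B) (hF : fisher M Z θ = Bᵀ * B) {ζ r : ℝ} (hζ : 0 ≤ ζ) (hr : 0 ≤ r)
    (hA : ∀ i, ∑ j, A i j ^ 2 ≤ ζ ^ 2)
    (hscore : ∑ j, (∑ i, A i j * (y i - deriv M.b ((Z *ᵥ θ) i))) ^ 2 ≤ r ^ 2)
    (hsmall : 2 * M.Cdev * ζ * r < 1 / 2) (i : Fin n) : |(Z *ᵥ (m - θ)) i| ≤ 1 / 2 := by
  set η := Z *ᵥ θ with hη
  set u := Z *ᵥ (m - θ) with hu
  set v := B *ᵥ (m - θ) with hv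
  obtain ⟨k, -, hk⟩ := Finset.exists_max_image Finset.univ (fun i => |u i|)
    ⟨i, Finset.mem_univ i⟩
  refine (hk i (Finset.mem_univ i)).trans ?_
  by_contra! hlt
  -- the point of the segment at which the largest change of a predictor is exactly `1/2`
  set t := (2 * |u k|)⁻¹ with ht
  have hukpos : 0 < |u k| := by linarith
  have ht0 : 0 < t := by positivity
  have ht1 : t ≤ 1 := by rw [ht]; exact inv_le_one_of_one_le₀ (by linarith)
  have htk : t * |u k| = 1 / 2 := by rw [ht]; field_simp
  have htu : ∀ i, |t * u i| ≤ 1 / 2 := fun i => by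
    rw [abs_mul, abs_of_pos ht0, ← htk]
    exact mul_le_mul_of_nonneg_left (hk i (Finset.mem_univ i)) ht0.le
  have huA : u = A *ᵥ v := by rw [hu, hv, hZ, Matrix.mulVec_mulVec]
  set N := Real.sqrt (∑ j, v j ^ 2) with hN
  have hN2 : N ^ 2 = ∑ j, v j ^ 2 := Real.sq_sqrt (Finset.sum_nonneg fun j _ => sq_nonneg _)
  have hN0 : 0 ≤ N := Real.sqrt_nonneg _
  -- the quadratic term
  have hquad : ∑ i, deriv (deriv M.b) (η i) * u i ^ 2 = N ^ 2 := by
    rw [hu, hη, ← dotProduct_fisher M Z θ (m - θ), hF,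
      Matrix.dotProduct_transpose_mul_self_mulVec, hN2]
  -- the linear term
  have hlin : ∑ i, (y i - deriv M.b (η i)) * u i ≤ r * N := by
    have e : ∑ i, (y i - deriv M.b (η i)) * u i =
        ∑ j, (∑ i, A i j * (y i - deriv M.b (η i))) * v j := by
      simp_rw [huA, Matrix.mulVec, dotProduct, Finset.mul_sum, Finset.sum_mul]
      rw [Finset.sum_comm]
      exact Finset.sum_congr rfl fun j _ => Finset.sum_congr rfl fun i _ => by ring
    rw [e]
    refine (Real.sum_mul_le_sqrt_mul_sqrt _ _ _).trans ?_
    exact mul_le_mul_of_nonneg_right (Real.sqrt_le_iff.2 ⟨hr, hscore⟩) hN0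
  have hlev : |u k| ≤ ζ * N := by
    refine abs_le_of_sq_le_sq ?_ (by positivity)
    rw [mul_pow, hN2, huA]
    refine (Finset.sum_mul_sq_le_sq_mul_sq _ _ _).trans ?_
    exact mul_le_mul_of_nonneg_right (hA k) (Finset.sum_nonneg fun j _ => sq_nonneg _)
  -- concavity along the segment
  have hseg : 0 ≤ ∑ i, (y i * (t * u i) - (M.b (η i + t * u i) - M.b (η i))) := by
    have h1 : 0 ≤ t * (logLik M Z y m - logLik M Z y θ) :=
      mul_nonneg ht0.le (sub_nonneg.2 (hm θ))
    refine h1.trans ?_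
    rw [logLik, logLik, ← Finset.sum_sub_distrib, Finset.mul_sum]
    refine Finset.sum_le_sum fun i _ => ?_
    have hmi : (Z *ᵥ m) i = η i + u i := by simp [hu, hη, Matrix.mulVec_sub]
    have hθi : (Z *ᵥ θ) i = η i := rfl
    have hc := M.strictConvexOn_b.convexOn.2 (Set.mem_univ (η i)) (Set.mem_univ (η i + u i))
      (sub_nonneg.2 ht1) ht0.le (by ring)
    simp only [smul_eq_mul] at hc
    rw [show (1 - t) * η i + t * (η i + u i) = η i + t * u i by ring] at hc
    rw [hmi, hθi]
    linarith
  have hbreg : ∑ i, (y i * (t * u i) - (M.b (η i + t * u i) - M.b (η i))) ≤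
      t * (r * N) - M.Cdev⁻¹ / 2 * (t ^ 2 * N ^ 2) := by
    calc _ ≤ ∑ i, (t * ((y i - deriv M.b (η i)) * u i) -
          M.Cdev⁻¹ / 2 * (t ^ 2 * (deriv (deriv M.b) (η i) * u i ^ 2))) :=
          Finset.sum_le_sum fun i _ => by
            have := M.le_breg (x := η i) (htu i)
            rw [mul_pow] at this
            linarith
      _ = t * ∑ i, (y i - deriv M.b (η i)) * u i - M.Cdev⁻¹ / 2 * (t ^ 2 * N ^ 2) := by
          rw [Finset.sum_sub_distrib, ← Finset.mul_sum, ← Finset.mul_sum, ← Finset.mul_sum, hquad]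
      _ ≤ _ := by
          have := mul_le_mul_of_nonneg_left hlin ht0.le
          linarith
  have hNpos : 0 < t * N := by
    have : 0 < ζ * N := hukpos.trans_le hlev
    have hN' : N ≠ 0 := fun h => by rw [h, mul_zero] at this; exact this.false
    positivity
  have htN : t * N ≤ 2 * M.Cdev * r := by
    have h1 : M.Cdev⁻¹ / 2 * (t * N) * (t * N) ≤ r * (t * N) := by nlinarith [hseg.trans hbreg]
    have h2 := le_of_mul_le_mul_right h1 hNpos
    have hC := M.Cdev_pos
    calc t * N = 2 * M.Cdev * (M.Cdev⁻¹ / 2 * (t * N)) := by field_simp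
      _ ≤ 2 * M.Cdev * r := mul_le_mul_of_nonneg_left h2 (by positivity)
  have hfin : 1 / 2 ≤ 2 * M.Cdev * ζ * r := by
    calc (1 : ℝ) / 2 = t * |u k| := htk.symm
      _ ≤ t * (ζ * N) := mul_le_mul_of_nonneg_left hlev ht0.le
      _ = ζ * (t * N) := by ring
      _ ≤ ζ * (2 * M.Cdev * r) := mul_le_mul_of_nonneg_left htN hζ
      _ = _ := by ring
  linarith

/-- Near the maximum likelihood estimator the likelihood decays at most quadratically. -/
theorem logLik_mle_sub_le (M : ExpFamily) {Z : Matrix (Fin n) ι ℝ} {y : Fin n → ℝ}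
    {m : ι → ℝ} (hm : IsMLE M Z y m) {θ : ι → ℝ} (hθ : ∀ i, |(Z *ᵥ (θ - m)) i| ≤ 1 / 2) :
    logLik M Z y m - logLik M Z y θ ≤
      M.Cdev / 2 * ((θ - m) ⬝ᵥ (fisher M Z m *ᵥ (θ - m))) := by
  have hz : (Zᵀ *ᵥ y - meanMap M Z m) ⬝ᵥ (θ - m) = 0 := by
    rw [(isMLE_iff M Z y m).1 hm]; simp
  rw [meanMap, ← Matrix.mulVec_sub, transpose_mulVec_dotProduct] at hz
  rw [dotProduct_fisher, logLik, logLik, ← Finset.sum_sub_distrib, Finset.mul_sum,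
    ← add_zero (∑ i, (_ - _)), ← hz, ← Finset.sum_add_distrib]
  refine Finset.sum_le_sum fun i _ => ?_
  have h := M.breg_le (x := (Z *ᵥ m) i) (hθ i)
  have e : (Z *ᵥ m) i + (Z *ᵥ (θ - m)) i = (Z *ᵥ θ) i := by simp [Matrix.mulVec_sub]
  rw [e] at h
  have e' : (Z *ᵥ (θ - m)) i = (Z *ᵥ θ) i - (Z *ᵥ m) i := by simp [Matrix.mulVec_sub]
  simp only [Pi.sub_apply]
  rw [e'] at h ⊢
  linarith

variable [DecidableEq ι]

/-- A crude Laplace lower bound: the integral over a small cube around the estimator. -/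
theorem le_lintegral_normalDensity_mul (M : ExpFamily) {Z : Matrix (Fin n) ι ℝ}
    {y : Fin n → ℝ} {m : ι → ℝ} (hm : IsMLE M Z y m) (hF : (fisher M Z m).PosDef)
    {lam α ℓ c r : ℝ} (hlam : 0 < lam) (hα : 0 ≤ α) (hc : 0 < c) (hr : 0 ≤ r)
    (hℓ : ℓ ≤ logLik M Z y m) (hlow : ∀ x : ι → ℝ, c * (x ⬝ᵥ x) ≤ x ⬝ᵥ (fisher M Z m *ᵥ x))
    (hrow : ∀ i, (∑ j, |Z i j|) * r ≤ 1 / 2)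
    (hup : ∀ x : ι → ℝ, (∀ j, |x j| ≤ r) → x ⬝ᵥ (fisher M Z m *ᵥ x) ≤ 1) :
    ENNReal.ofReal (Real.exp (α * ℓ) * (Real.sqrt ((lam * c / (2 * Real.pi)) ^ Fintype.card ι) *
      Real.exp (-(lam + α * M.Cdev) / 2) * (2 * r) ^ Fintype.card ι)) ≤
    ∫⁻ θ, ENNReal.ofReal (normalDensity m (lam • fisher M Z m)⁻¹ θ) *
      ENNReal.ofReal (Real.exp (α * logLik M Z y θ)) := by
  have hdet : (lam * c) ^ Fintype.card ι ≤ (lam • fisher M Z m).det := by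
    have h1 : ((lam * c) • (1 : Matrix ι ι ℝ)).PosDef := Matrix.PosDef.one.smul (by positivity)
    have := h1.det_le_det (hF.smul hlam) fun x => by
      rw [quadForm_smul, quadForm_smul, Matrix.one_mulVec, mul_assoc]
      exact mul_le_mul_of_nonneg_left (hlow x) hlam.le
    simpa using this
  have hsqrt : Real.sqrt ((lam * c / (2 * Real.pi)) ^ Fintype.card ι) ≤
      Real.sqrt ((lam • fisher M Z m).det / (2 * Real.pi) ^ Fintype.card ι) := by
    refine Real.sqrt_le_sqrt ?_
    rw [div_pow]
    gcongr
  set c₀ := Real.exp (α * ℓ) * (Real.sqrt ((lam * c / (2 * Real.pi)) ^ Fintype.card ι) *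
    Real.exp (-(lam + α * M.Cdev) / 2)) with hc₀
  have hpt : ∀ θ ∈ Metric.closedBall m r,
      ENNReal.ofReal c₀ ≤ ENNReal.ofReal (normalDensity m (lam • fisher M Z m)⁻¹ θ) *
        ENNReal.ofReal (Real.exp (α * logLik M Z y θ)) := by
    intro θ hθ
    have hθj : ∀ j, |(θ - m) j| ≤ r := fun j => by
      have := (dist_pi_le_iff hr).1 (Metric.mem_closedBall.1 hθ) j
      rwa [Real.dist_eq] at this
    have hpred : ∀ i, |(Z *ᵥ (θ - m)) i| ≤ 1 / 2 := fun i => by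
      refine le_trans ?_ (hrow i)
      rw [Matrix.mulVec, dotProduct, Finset.sum_mul]
      refine (Finset.abs_sum_le_sum_abs _ _).trans (Finset.sum_le_sum fun j _ => ?_)
      rw [abs_mul]
      exact mul_le_mul_of_nonneg_left (hθj j) (abs_nonneg _)
    have hq := hup _ hθj
    have hq0 : 0 ≤ (θ - m) ⬝ᵥ (fisher M Z m *ᵥ (θ - m)) := by
      simpa using hF.posSemidef.dotProduct_mulVec_nonneg (θ - m)
    have hL := logLik_mle_sub_le M hm hpred
    have hC := M.Cdev_pos
    rw [normalDensity_inv m (hF.smul hlam), quadForm_smul,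
      ← ENNReal.ofReal_mul (by positivity)]
    refine ENNReal.ofReal_le_ofReal ?_
    rw [hc₀, mul_left_comm, ← Real.exp_add, mul_assoc, ← Real.exp_add]
    refine mul_le_mul hsqrt (Real.exp_le_exp.2 ?_) (Real.exp_pos _).le (Real.sqrt_nonneg _)
    set q := (θ - m) ⬝ᵥ (fisher M Z m *ᵥ (θ - m))
    have e1 : lam * q ≤ lam := by nlinarith
    have e2 : α * (ℓ - M.Cdev / 2) ≤ α * logLik M Z y θ := by
      refine mul_le_mul_of_nonneg_left ?_ hα
      nlinarith
    linarith
  calc _ = ENNReal.ofReal c₀ * volume (Metric.closedBall m r) := by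
        rw [Real.volume_pi_closedBall m hr, ← ENNReal.ofReal_mul (by positivity), hc₀]
        congr 1; ring
    _ = ∫⁻ _ in Metric.closedBall m r, ENNReal.ofReal c₀ := (setLIntegral_const _ _).symm
    _ ≤ ∫⁻ θ in Metric.closedBall m r, _ :=
        setLIntegral_mono' Metric.isClosed_closedBall.measurableSet hpt
    _ ≤ _ := setLIntegral_le_lintegral _ _

end

end GLM

/-! ### Expected posterior mass of large models at a fixed sample size -/

namespace GLM

variable {n p : ℕ} (M : ExpFamily) (X : Matrix (Fin n) (Fin p) ℝ)

theorem rhoMin_mul_le (θ₀ : Fin p → ℝ) (S : Finset (Fin p)) (x : S → ℝ) :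
    rhoMin M X θ₀ S * (x ⬝ᵥ x) ≤ x ⬝ᵥ (fisherBest M X θ₀ S *ᵥ x) :=
  (fisher_isHermitian M (cols X S) (best M X θ₀ S)).mul_le_dotProduct
    (fun j => ciInf_le (Set.finite_range _).bddBelow j) x

theorem le_rhoMax_mul (θ₀ : Fin p → ℝ) (S : Finset (Fin p)) (x : S → ℝ) :
    x ⬝ᵥ (fisherBest M X θ₀ S *ᵥ x) ≤ rhoMax M X θ₀ S * (x ⬝ᵥ x) :=
  (fisher_isHermitian M (cols X S) (best M X θ₀ S)).dotProduct_le_mul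
    (fun j => le_ciSup (f := fun j =>
      (fisher_isHermitian M (cols X S) (best M X θ₀ S)).eigenvalues j)
      (Set.finite_range _).bddAbove j) x

theorem rhoMin_pos {θ₀ : Fin p → ℝ} {S : Finset (Fin p)} (hS : S.Nonempty)
    (h : IsUnit (fisherBest M X θ₀ S).det) : 0 < rhoMin M X θ₀ S := by
  have : Nonempty S := hS.to_subtype
  obtain ⟨j, hj⟩ := exists_eq_ciInf_of_finite
    (f := fun j => (fisher_isHermitian M (cols X S) (best M X θ₀ S)).eigenvalues j)
  rw [rhoMin, ← hj]
  exact (fisher_posDef M h).eigenvalues_pos j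

theorem rowSum_le_rowSumNorm {ι : Type*} [Fintype ι] (Z : Matrix (Fin n) ι ℝ) (i : Fin n) :
    ∑ j, |Z i j| ≤ rowSumNorm Z :=
  le_ciSup (f := fun i => ∑ j, |Z i j|) (Set.finite_range _).bddAbove i

theorem designReg_nonneg (θ₀ : Fin p → ℝ) (S : Finset (Fin p)) : 0 ≤ designReg M X θ₀ S :=
  Real.iSup_nonneg fun _ => Real.sqrt_nonneg _

theorem mahalanobis_le_designReg_sq (θ₀ : Fin p → ℝ) (S : Finset (Fin p)) (i : Fin n) :
    cols X S i ⬝ᵥ ((fisherBest M X θ₀ S)⁻¹ *ᵥ cols X S i) ≤ designReg M X θ₀ S ^ 2 := by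
  have h := le_ciSup (f := fun i => Real.sqrt (cols X S i ⬝ᵥ
    ((fisherBest M X θ₀ S)⁻¹ *ᵥ cols X S i))) (Set.finite_range _).bddAbove i
  exact (Real.sqrt_le_left (designReg_nonneg M X θ₀ S)).1 h

/-- The lower bound for the normalizing constant, relative to the likelihood of the truth, that
comes from a cube of half-width `r` around the estimator in the true model. -/
noncomputable def evidenceBound (θ₀ : Fin p → ℝ) (w : ℕ → ℝ) (lam α r : ℝ) : ℝ :=
  w (supp θ₀).card / (p.choose (supp θ₀).card : ℝ) *
    (Real.sqrt ((lam * (M.Cdev⁻¹ * rhoMin M X θ₀ (supp θ₀)) / (2 * Real.pi)) ^ (supp θ₀).card) *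
      Real.exp (-(lam + α * M.Cdev) / 2) * (2 * r) ^ (supp θ₀).card)

/-- On the event where the whitened score of the true model is bounded coordinatewise by `τ`, the
estimator of the true model is localized near the truth, and the evidence is bounded below. -/
theorem evidenceBound_le {θ₀ : Fin p → ℝ} (hθ₀ : (supp θ₀).Nonempty)
    (hns : IsUnit (fisherBest M X θ₀ (supp θ₀)).det) {w : ℕ → ℝ} (hw : ∀ s, 0 ≤ w s)
    {lam α τ r : ℝ} (hlam : 0 < lam) (hα : 0 ≤ α) (hτ : 0 ≤ τ) (hr : 0 ≤ r)
    {A : Matrix (Fin n) (supp θ₀) ℝ} {B : Matrix (supp θ₀) (supp θ₀) ℝ}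
    (hZ : cols X (supp θ₀) = A * B) (hF : fisherBest M X θ₀ (supp θ₀) = Bᵀ * B)
    (hA : ∀ i, ∑ j, A i j ^ 2 ≤ designReg M X θ₀ (supp θ₀) ^ 2)
    (hsmall : 2 * M.Cdev * designReg M X θ₀ (supp θ₀) *
      (Real.sqrt (supp θ₀).card * τ) < 1 / 2)
    (hrow : rowSumNorm (cols X (supp θ₀)) * r ≤ 1 / 2)
    (hup : M.Cdev * (rhoMax M X θ₀ (supp θ₀) * ((supp θ₀).card * r ^ 2)) ≤ 1)
    {y : Fin n → ℝ} (hmle : ∃ θ, IsMLE M (cols X (supp θ₀)) y θ)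
    (hy : ∀ j, |∑ i, A i j * (y i - deriv M.b ((X *ᵥ θ₀) i))| ≤ τ) :
    ENNReal.ofReal (Real.exp (α * logLik M X y θ₀)) *
        ENNReal.ofReal (evidenceBound M X θ₀ w lam α r) ≤
      ∫⁻ θ, ENNReal.ofReal (Real.exp (α * logLik M X y θ)) ∂(prior M X w lam y) := by
  set Z := cols X (supp θ₀) with hZdef
  set m := mle M Z y with hmdef
  set θs := best M X θ₀ (supp θ₀) with hθs
  have hm : IsMLE M Z y m := isMLE_mle M hmle
  have hpred : Z *ᵥ θs = X *ᵥ θ₀ := cols_mulVec_best M X θ₀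
  have hscore : ∑ j, (∑ i, A i j * (y i - deriv M.b ((Z *ᵥ θs) i))) ^ 2 ≤
      (Real.sqrt (supp θ₀).card * τ) ^ 2 := by
    rw [mul_pow, Real.sq_sqrt (Nat.cast_nonneg _), hpred]
    calc _ ≤ ∑ _j : (supp θ₀), τ ^ 2 := Finset.sum_le_sum fun j _ => sq_le_sq' (abs_le.1 (hy j)).1
          (abs_le.1 (hy j)).2
      _ = (supp θ₀).card * τ ^ 2 := by simp
  have hclose := abs_mulVec_sub_le M hm hZ (θ := θs) hF (designReg_nonneg M X θ₀ (supp θ₀))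
    (by positivity) hA hscore hsmall
  have hZm : ∀ i, (Z *ᵥ m) i = (Z *ᵥ θs) i + (Z *ᵥ (m - θs)) i := fun i => by
    simp [Matrix.mulVec_sub]
  have hlow : ∀ x : (supp θ₀) → ℝ, M.Cdev⁻¹ * rhoMin M X θ₀ (supp θ₀) * (x ⬝ᵥ x) ≤
      x ⬝ᵥ (fisher M Z m *ᵥ x) := fun x => by
    have h1 := mul_le_mul_of_nonneg_left (rhoMin_mul_le M X θ₀ (supp θ₀) x)
      (inv_pos.2 M.Cdev_pos).le
    rw [mul_assoc]
    refine h1.trans ?_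
    rw [fisherBest, dotProduct_fisher, dotProduct_fisher, Finset.mul_sum]
    refine Finset.sum_le_sum fun i _ => ?_
    rw [← mul_assoc]
    refine mul_le_mul_of_nonneg_right ?_ (sq_nonneg _)
    have := M.le_var (x := (Z *ᵥ θs) i) (hclose i)
    rwa [← hZm] at this
  have hupper : ∀ x : (supp θ₀) → ℝ, x ⬝ᵥ (fisher M Z m *ᵥ x) ≤
      M.Cdev * (rhoMax M X θ₀ (supp θ₀) * (x ⬝ᵥ x)) := fun x => by
    have h1 := mul_le_mul_of_nonneg_left (le_rhoMax_mul M X θ₀ (supp θ₀) x) M.Cdev_pos.le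
    refine le_trans ?_ h1
    rw [fisherBest, dotProduct_fisher, dotProduct_fisher, Finset.mul_sum]
    refine Finset.sum_le_sum fun i _ => ?_
    rw [← mul_assoc]
    refine mul_le_mul_of_nonneg_right ?_ (sq_nonneg _)
    have := M.var_le (x := (Z *ᵥ θs) i) (hclose i)
    rwa [← hZm] at this
  have hinj : Function.Injective fun x : (supp θ₀) → ℝ => Z *ᵥ x := injective_mulVec_of_fisher M hns
  have hρ := rhoMin_pos M X hθ₀ hns
  have hρ' : 0 ≤ rhoMax M X θ₀ (supp θ₀) := by
    have : Nonempty (supp θ₀) := hθ₀.to_subtype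
    exact Real.iSup_nonneg fun j => (fisher_posDef M hns).posSemidef.eigenvalues_nonneg j
  have hLℓ : logLik M X y θ₀ ≤ logLik M Z y m := by
    refine le_trans (le_of_eq ?_) (hm θs)
    simp only [logLik, hpred]
  have hC := M.Cdev_pos
  have key := le_lintegral_normalDensity_mul M hm (fisher_posDef_of_injective M hinj m)
    (c := M.Cdev⁻¹ * rhoMin M X θ₀ (supp θ₀)) (r := r) hlam hα (by positivity) hr hLℓ hlow
    (fun i => (mul_le_mul_of_nonneg_right (rowSum_le_rowSumNorm Z i) hr).trans hrow)
    (fun x hx => by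
      refine (hupper x).trans (le_trans ?_ hup)
      refine mul_le_mul_of_nonneg_left (mul_le_mul_of_nonneg_left ?_ hρ') hC.le
      calc x ⬝ᵥ x ≤ ∑ _j : (supp θ₀), r ^ 2 := Finset.sum_le_sum fun j _ => by
            rw [← pow_two]; exact sq_le_sq' (abs_le.1 (hx j)).1 (abs_le.1 (hx j)).2
        _ = (supp θ₀).card * r ^ 2 := by simp)
  rw [Fintype.card_coe] at key
  have hsum := setLIntegral_prior M X w lam α y MeasurableSet.univ
  rw [Measure.restrict_univ] at hsum
  rw [hsum]
  refine le_trans ?_ (Finset.single_le_sum (f := fun S : Finset (Fin p) =>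
    ENNReal.ofReal (w S.card / (p.choose S.card : ℝ)) *
        ∫⁻ θ, ENNReal.ofReal (slab M X lam y S θ) * (extend S ⁻¹' Set.univ).indicator
          (fun θ => ENNReal.ofReal (Real.exp (α * logLik M (cols X S) y θ))) θ)
    (fun _ _ => zero_le) (Finset.mem_univ (supp θ₀)))
  simp only [Set.preimage_univ, Set.indicator_univ]
  rw [evidenceBound, ENNReal.ofReal_mul (div_nonneg (hw _) (Nat.cast_nonneg _)),
    mul_left_comm, ← ENNReal.ofReal_mul (Real.exp_pos _).le]
  exact mul_le_mul_right key _

/-- If `f`, with values in `[0, 1]`, is at most `h` on the intersection of `E` with a measurable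
event `G`, its expectation is at most the expectation of `h` plus the probabilities
of the two exceptional events. The event `E` itself need not be measurable, since it is contained
in the measurable set where the bound holds or `G` fails. -/
theorem lintegral_posterior_le_of_events {θ₀ : Fin p → ℝ} {f h : (Fin n → ℝ) → ℝ≥0∞}
    (hf : Measurable f) (hf1 : ∀ y, f y ≤ 1) (hh : Measurable h) {E G : Set (Fin n → ℝ)}
    (hG : MeasurableSet G) (hEG : ∀ y ∈ E, y ∈ G → f y ≤ h y) {δ ε : ℝ}
    (hE : ENNReal.ofReal (1 - δ) ≤ jointLaw M X θ₀ E)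
    (hGc : jointLaw M X θ₀ Gᶜ ≤ ENNReal.ofReal ε) :
    ∫⁻ y, f y ∂(jointLaw M X θ₀) ≤
      ENNReal.ofReal δ + ENNReal.ofReal ε + ∫⁻ y, h y ∂(jointLaw M X θ₀) := by
  set P := jointLaw M X θ₀
  set V : Set (Fin n → ℝ) := {y | f y ≤ h y} ∪ Gᶜ with hV
  have hVm : MeasurableSet V := (measurableSet_le hf hh).union hG.compl
  have hEV : E ⊆ V := fun y hy => by
    by_cases hyG : y ∈ G
    · exact Or.inl (hEG y hy hyG)
    · exact Or.inr hyG
  have hVc : P Vᶜ ≤ ENNReal.ofReal δ := by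
    rw [prob_compl_eq_one_sub hVm, tsub_le_iff_right]
    calc (1 : ℝ≥0∞) = ENNReal.ofReal (δ + (1 - δ)) := by simp
      _ ≤ ENNReal.ofReal δ + ENNReal.ofReal (1 - δ) := ENNReal.ofReal_add_le
      _ ≤ ENNReal.ofReal δ + P V := by gcongr; exact hE.trans (measure_mono hEV)
  have hpt : ∀ y, f y ≤ Vᶜ.indicator 1 y + Gᶜ.indicator 1 y + h y := fun y => by
    by_cases hyV : y ∈ V
    · by_cases hyG : y ∈ G
      · rcases hyV with hy | hy
        · exact le_add_of_nonneg_of_le zero_le hy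
        · exact absurd hyG hy
      · have : y ∈ Gᶜ := hyG
        simp only [Set.indicator_of_mem this, Pi.one_apply]
        exact (hf1 y).trans (le_add_right (le_add_left le_rfl))
    · have : y ∈ Vᶜ := hyV
      simp only [Set.indicator_of_mem this, Pi.one_apply]
      exact (hf1 y).trans (le_add_right (le_add_right le_rfl))
  refine (lintegral_mono hpt).trans ?_
  rw [lintegral_add_right _ hh, lintegral_add_right _ (measurable_one.indicator hG.compl),
    lintegral_indicator_one hVm.compl, lintegral_indicator_one hG.compl]
  gcongr

/-- The expected posterior mass of the models of size larger than `κ`. -/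
theorem lintegral_posterior_le {θ₀ : Fin p → ℝ} (hθ₀ : (supp θ₀).Nonempty)
    (hnsb : IsUnit (fisherBest M X θ₀ (supp θ₀)).det) {w : ℕ → ℝ} (hw : ∀ s, 0 ≤ w s)
    (hw₀ : 0 < w (supp θ₀).card) {lam α D κ t τ r δ : ℝ} (hlam : 0 < lam) (hα : 0 ≤ α)
    (hα1 : α ≤ 1) (hD : 0 < D) (ht : 0 < t) (hτ : 0 ≤ τ) (hr : 0 < r)
    {θbar : ∀ S : Finset (Fin p), S → ℝ}
    (hns : ∀ S : Finset (Fin p), w S.card ≠ 0 → IsUnit (fisher M (cols X S) (θbar S)).det)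
    {E : Set (Fin n → ℝ)} (hE : ENNReal.ofReal (1 - δ) ≤ jointLaw M X θ₀ E)
    (hEclose : ∀ y ∈ E, ∀ S : Finset (Fin p), w S.card ≠ 0 →
      (∃ θ, IsMLE M (cols X S) y θ) ∧
      (fisher M (cols X S) (mle M (cols X S) y) -
        D⁻¹ • fisher M (cols X S) (θbar S)).PosSemidef ∧
      (D • fisher M (cols X S) (θbar S) -
        fisher M (cols X S) (mle M (cols X S) y)).PosSemidef ∧
      (mle M (cols X S) y - θbar S) ⬝ᵥ
        (fisher M (cols X S) (θbar S) *ᵥ (mle M (cols X S) y - θbar S)) ≤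
          D * (S.card : ℝ) * Real.log p)
    (hlev : t * designReg M X θ₀ (supp θ₀) ≤ 1 / 2)
    (hsmall : 2 * M.Cdev * designReg M X θ₀ (supp θ₀) *
      (Real.sqrt (supp θ₀).card * τ) < 1 / 2)
    (hrow : rowSumNorm (cols X (supp θ₀)) * r ≤ 1 / 2)
    (hup : M.Cdev * (rhoMax M X θ₀ (supp θ₀) * ((supp θ₀).card * r ^ 2)) ≤ 1) :
    ∫⁻ y, posterior M X w lam α y {θ | κ < ((supp θ).card : ℝ)} ∂(jointLaw M X θ₀) ≤
      ENNReal.ofReal δ +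
      ENNReal.ofReal (2 * (supp θ₀).card * Real.exp (M.Cdev / 2 * t ^ 2 - t * τ)) +
      ENNReal.ofReal ((∑ S : Finset (Fin p), inflatedWeight w lam D κ S) /
        evidenceBound M X θ₀ w lam α r) := by
  obtain ⟨A, B, hZ, hF, hAcol, hArow⟩ := exists_whitening M hnsb
  have hArow' : ∀ i, ∑ j, A i j ^ 2 ≤ designReg M X θ₀ (supp θ₀) ^ 2 := fun i =>
    (hArow i).le.trans (mahalanobis_le_designReg_sq M X θ₀ (supp θ₀) i)
  have hζ := designReg_nonneg M X θ₀ (supp θ₀)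
  have hent : ∀ i j, |t * A i j| ≤ 1 / 2 := fun i j => by
    rw [abs_mul, abs_of_pos ht]
    refine (mul_le_mul_of_nonneg_left ?_ ht.le).trans hlev
    refine abs_le_of_sq_le_sq ?_ hζ
    exact (Finset.single_le_sum (f := fun j => A i j ^ 2) (fun j _ => sq_nonneg _)
      (Finset.mem_univ j)).trans (hArow' i)
  rw [cols_mulVec_best] at hAcol
  have htail := score_tail M X θ₀ A (τ := τ) ht hent hAcol
  rw [Fintype.card_coe] at htail
  set G : Set (Fin n → ℝ) := {y | ∀ j, |∑ i, A i j * (y i - deriv M.b ((X *ᵥ θ₀) i))| ≤ τ}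
    with hG
  have hGm : MeasurableSet G := by
    rw [hG, Set.ofPred_forall]
    exact MeasurableSet.iInter fun j => measurableSet_le (by fun_prop) measurable_const
  have hGc : Gᶜ = {y | ∃ j, τ < |∑ i, A i j * (y i - deriv M.b ((X *ᵥ θ₀) i))|} := by
    ext y; simp [hG]
  have hd : 0 < evidenceBound M X θ₀ w lam α r := by
    have hρ := rhoMin_pos M X hθ₀ hnsb
    have hC := M.Cdev_pos
    have hch : 0 < (p.choose (supp θ₀).card : ℝ) := by
      exact_mod_cast Nat.choose_pos ((Finset.card_le_univ _).trans_eq (Fintype.card_fin p))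
    unfold evidenceBound
    positivity
  have hinj : ∀ S : Finset (Fin p), w S.card ≠ 0 →
      Function.Injective fun x : S → ℝ => cols X S *ᵥ x := fun S hS =>
    injective_mulVec_of_fisher M (hns S hS)
  have hgm : ∀ S : Finset (Fin p), Measurable
      (normalDensity (θbar S) ((lam / (2 * D)) • fisher M (cols X S) (θbar S))⁻¹) := fun S =>
    measurable_normalDensity _ _
  have hmix := measurable_mixture M X θ₀ α (inflatedWeight w lam D κ) hgm
  have hcoef : ∀ S : Finset (Fin p), 0 ≤ inflatedWeight w lam D κ S := fun S => by
    unfold inflatedWeight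
    split_ifs
    · have := hw S.card
      positivity
    · exact le_rfl
  refine (lintegral_posterior_le_of_events M X
    (measurable_posterior M X hlam α hinj (measurableSet_card_supp κ))
    (fun y => posterior_le_one M X w lam α y _)
    (hmix.div_const (ENNReal.ofReal (evidenceBound M X θ₀ w lam α r))) hGm
    (fun y hyE hyG => ?_) hE (hGc ▸ htail)).trans ?_
  · have hnum := setLIntegral_prior_le_mixture M X θ₀ hw (α := α) hD hlam κ y θbar hns
      (fun S hS => (hEclose y hyE S hS).2.1) (fun S hS => (hEclose y hyE S hS).2.2.1)
      (fun S hS => (hEclose y hyE S hS).2.2.2)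
    have hden := evidenceBound_le M X hθ₀ hnsb hw hlam hα hτ hr.le hZ hF hArow' hsmall hrow hup
      (hEclose y hyE _ hw₀.ne').1 hyG
    refine (ENNReal.div_le_div hnum hden).trans_eq ?_
    exact ENNReal.mul_div_mul_left _ _ (by simpa using Real.exp_pos _) ENNReal.ofReal_ne_top
  · refine add_le_add le_rfl ?_
    simp_rw [ENNReal.div_eq_inv_mul]
    rw [lintegral_const_mul _ hmix, ← ENNReal.div_eq_inv_mul, ENNReal.ofReal_div_of_pos hd]
    refine ENNReal.div_le_div_right (lintegral_mixture_le M X θ₀ hα hα1 hcoef hgm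
      fun S hS => ?_) _
    have hS' : w S.card ≠ 0 := fun h => hS (by simp [inflatedWeight, h])
    exact lintegral_normalDensity_inv _ ((fisher_posDef M (hns S hS')).smul (by positivity))

end GLM

/-! ### Polynomial bounds in the dimension -/

namespace GLM

theorem sum_inflatedWeight {p : ℕ} (w : ℕ → ℝ) (lam D κ : ℝ) :
    ∑ S : Finset (Fin p), inflatedWeight w lam D κ S = ∑ s ∈ Finset.range (p + 1),
      if κ < (s : ℝ) then w s * (Real.exp (lam * (s * Real.log p) / 2) *
        (Real.sqrt 2 * D) ^ s) else 0 := by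
  have h := Finset.sum_powerset_apply_card (fun s : ℕ => if κ < (s : ℝ) then
    w s / (p.choose s : ℝ) * (Real.exp (lam * (s * Real.log p) / 2) *
      (Real.sqrt 2 * D) ^ s) else 0) (x := (Finset.univ : Finset (Fin p)))
  rw [Finset.powerset_univ, Finset.card_univ, Fintype.card_fin] at h
  refine h.trans (Finset.sum_congr rfl fun s hs => ?_)
  have hch : (p.choose s : ℝ) ≠ 0 := by
    exact_mod_cast (Nat.choose_pos (Nat.lt_succ_iff.1 (Finset.mem_range.1 hs))).ne'
  split_ifs
  · rw [nsmul_eq_mul, ← mul_assoc, mul_div_cancel₀ _ hch]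
  · simp

theorem weight_decay {w : ℕ → ℝ} {c : ℝ} (hc : 0 ≤ c) {m : ℕ}
    (h : ∀ s, 1 ≤ s → s ≤ m → w s ≤ c * w (s - 1)) (s₀ k : ℕ) (hk : s₀ + k ≤ m) :
    w (s₀ + k) ≤ c ^ k * w s₀ := by
  induction k with
  | zero => simp
  | succ k ih =>
    have h1 := h (s₀ + (k + 1)) (by omega) hk
    rw [show s₀ + (k + 1) - 1 = s₀ + k by omega] at h1
    refine h1.trans ((mul_le_mul_of_nonneg_left (ih (by omega)) hc).trans_eq ?_)
    ring

/-- The prior decay `p^{-A₄}` per covariate beats the inflation `p^{λ/2 + o(1)}` per covariate, as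
`λ` is smaller than `A₄`. -/
theorem sum_inflatedWeight_le {p : ℕ} (hp : (2 : ℝ) ≤ p) {w : ℕ → ℝ} (hw : ∀ s, 0 ≤ w s)
    {smax s₀ : ℕ} (hs₀ : 1 ≤ s₀) {A₂ A₄ lam D K : ℝ} (hA₂ : 0 < A₂) (hA₄ : 0 < A₄)
    (hws : ∀ s, smax < s → w s = 0)
    (hdec : ∀ s, 1 ≤ s → s ≤ smax → w s ≤ A₂ * (p : ℝ) ^ (-A₄) * w (s - 1))
    (hA₂p : A₂ ≤ (p : ℝ) ^ (A₄ / 8)) (hlam : lam ≤ A₄) (hD : Real.sqrt 2 ≤ D)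
    (hDp : D ≤ (p : ℝ) ^ (A₄ / 16)) (hK : 1 ≤ K) :
    ∑ S : Finset (Fin p), inflatedWeight w lam D (K * s₀) S ≤
      w s₀ * (p : ℝ) ^ ((A₄ + 2 - A₄ / 4 * K) * s₀) := by
  have hp0 : (0 : ℝ) < p := by linarith
  have hp1 : (1 : ℝ) ≤ p := by linarith
  have hs₀' : (1 : ℝ) ≤ s₀ := by exact_mod_cast hs₀
  have hDpos : 0 < D := (Real.sqrt_pos.2 two_pos).trans_le hD
  rw [sum_inflatedWeight]
  have hterm : ∀ s ∈ Finset.range (p + 1), (if K * s₀ < (s : ℝ) then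
      w s * (Real.exp (lam * (s * Real.log p) / 2) * (Real.sqrt 2 * D) ^ s) else 0) ≤
      w s₀ * (p : ℝ) ^ (A₄ * s₀ - A₄ / 4 * (K * s₀)) := by
    intro s _
    have hnn : 0 ≤ w s₀ * (p : ℝ) ^ (A₄ * s₀ - A₄ / 4 * (K * s₀)) :=
      mul_nonneg (hw _) (Real.rpow_nonneg hp0.le _)
    split_ifs with hs
    swap
    · exact hnn
    by_cases hsm : smax < s
    · rw [hws s hsm, zero_mul]; exact hnn
    have hs0s : s₀ ≤ s := by
      have : (s₀ : ℝ) < s := lt_of_le_of_lt (by nlinarith) hs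
      exact_mod_cast this.le
    obtain ⟨k, rfl⟩ := Nat.exists_eq_add_of_le hs0s
    have h1 : w (s₀ + k) ≤ ((p : ℝ) ^ (-(7 / 8 * A₄))) ^ k * w s₀ := by
      refine (weight_decay (by positivity) hdec s₀ k (by omega)).trans ?_
      refine mul_le_mul_of_nonneg_right (pow_le_pow_left₀ (by positivity) ?_ k) (hw _)
      calc A₂ * (p : ℝ) ^ (-A₄) ≤ (p : ℝ) ^ (A₄ / 8) * (p : ℝ) ^ (-A₄) := by gcongr
        _ = (p : ℝ) ^ (-(7 / 8 * A₄)) := by rw [← Real.rpow_add hp0]; congr 1; ring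
    have h2 : Real.exp (lam * ((s₀ + k : ℕ) * Real.log p) / 2) ≤
        ((p : ℝ) ^ (A₄ / 2)) ^ (s₀ + k) := by
      rw [← Real.rpow_natCast, ← Real.rpow_mul hp0.le, Real.rpow_def_of_pos hp0]
      refine Real.exp_le_exp.2 ?_
      have : 0 ≤ ((s₀ + k : ℕ) : ℝ) * Real.log p :=
        mul_nonneg (Nat.cast_nonneg _) (Real.log_nonneg hp1)
      nlinarith
    have h3 : (Real.sqrt 2 * D) ^ (s₀ + k) ≤ ((p : ℝ) ^ (A₄ / 8)) ^ (s₀ + k) := by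
      refine pow_le_pow_left₀ (by positivity) ?_ _
      calc Real.sqrt 2 * D ≤ (p : ℝ) ^ (A₄ / 16) * (p : ℝ) ^ (A₄ / 16) :=
            mul_le_mul (hD.trans hDp) hDp hDpos.le (by positivity)
        _ = (p : ℝ) ^ (A₄ / 8) := by rw [← Real.rpow_add hp0]; congr 1; ring
    calc _ ≤ (((p : ℝ) ^ (-(7 / 8 * A₄))) ^ k * w s₀) *
          (((p : ℝ) ^ (A₄ / 2)) ^ (s₀ + k) * ((p : ℝ) ^ (A₄ / 8)) ^ (s₀ + k)) := by
          have := hw s₀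
          gcongr
      _ = w s₀ * (p : ℝ) ^ (-(7 / 8 * A₄) * k + (A₄ / 2 * (s₀ + k : ℕ) +
            A₄ / 8 * (s₀ + k : ℕ))) := by
          rw [Real.rpow_add hp0, Real.rpow_add hp0]
          simp only [Real.rpow_mul hp0.le, Real.rpow_natCast]
          ring
      _ ≤ _ := by
          refine mul_le_mul_of_nonneg_left (Real.rpow_le_rpow_of_exponent_le hp1 ?_) (hw _)
          push_cast at hs ⊢
          nlinarith
  refine (Finset.sum_le_sum hterm).trans ?_
  rw [Finset.sum_const, Finset.card_range, nsmul_eq_mul, mul_left_comm]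
  refine mul_le_mul_of_nonneg_left ?_ (hw _)
  have hcount : ((p + 1 : ℕ) : ℝ) ≤ (p : ℝ) ^ (2 * s₀ : ℝ) := by
    calc ((p + 1 : ℕ) : ℝ) ≤ (p : ℝ) ^ (2 : ℝ) := by
          rw [Real.rpow_two]; push_cast; nlinarith
      _ ≤ _ := Real.rpow_le_rpow_of_exponent_le hp1 (by linarith)
  calc _ ≤ (p : ℝ) ^ (2 * s₀ : ℝ) * (p : ℝ) ^ (A₄ * s₀ - A₄ / 4 * (K * s₀)) := by gcongr
    _ = _ := by rw [← Real.rpow_add hp0]; congr 1; ring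

theorem le_evidenceBound {n p : ℕ} (M : ExpFamily) (X : Matrix (Fin n) (Fin p) ℝ)
    {θ₀ : Fin p → ℝ} (hp : (1 : ℝ) ≤ p) (hθ₀ : (supp θ₀).Nonempty)
    (hns : IsUnit (fisherBest M X θ₀ (supp θ₀)).det) {w : ℕ → ℝ} (hw : ∀ s, 0 ≤ w s)
    {lam α A₅ A₆ H : ℝ} (hH : 0 ≤ H) (hA₅ : 0 < A₅) (hα : α ≤ 1)
    (hlam : (p : ℝ) ^ (-A₅) ≤ lam) (hlam' : lam ≤ A₆)
    (hlog : (A₆ + M.Cdev) / 2 ≤ Real.log p) (hC : 2 * Real.pi * M.Cdev ≤ p)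
    (hρ : (rhoMin M X θ₀ (supp θ₀))⁻¹ ≤ (p : ℝ) ^ H) :
    w (supp θ₀).card * (p : ℝ) ^ (-(A₅ + 2 * H + 4) * (supp θ₀).card) ≤
      evidenceBound M X θ₀ w lam α ((p : ℝ) ^ (-(H + 1))) := by
  have hp0 : (0 : ℝ) < p := by linarith
  have hlam0 : 0 < lam := (Real.rpow_pos_of_pos hp0 _).trans_le hlam
  have hCp := M.Cdev_pos
  have hρ0 := rhoMin_pos M X hθ₀ hns
  set s := (supp θ₀).card with hs
  have hs1 : 1 ≤ s := hθ₀.card_pos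
  have hs1' : (1 : ℝ) ≤ s := by exact_mod_cast hs1
  have hsp : s ≤ p := (Finset.card_le_univ _).trans_eq (Fintype.card_fin p)
  have hch0 : (0 : ℝ) < p.choose s := by exact_mod_cast Nat.choose_pos hsp
  have hch : (p.choose s : ℝ) ≤ (p : ℝ) ^ s := by exact_mod_cast Nat.choose_le_pow p s
  set Q := (p : ℝ) ^ (-(A₅ + H + 1)) with hQ
  have hQ0 : 0 < Q := Real.rpow_pos_of_pos hp0 _
  have hQ1 : Q ≤ 1 := Real.rpow_le_one_of_one_le_of_nonpos hp (by linarith)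
  have hbase : Q ≤ lam * (M.Cdev⁻¹ * rhoMin M X θ₀ (supp θ₀)) / (2 * Real.pi) := by
    have h1 : (p : ℝ) ^ (-H) ≤ rhoMin M X θ₀ (supp θ₀) := by
      rw [Real.rpow_neg hp0.le]
      exact inv_le_of_inv_le₀ hρ0 hρ
    have h2 : (p : ℝ) ^ (-1 : ℝ) ≤ (2 * Real.pi * M.Cdev)⁻¹ := by
      rw [Real.rpow_neg_one]
      exact inv_anti₀ (by positivity) hC
    calc Q = (p : ℝ) ^ (-A₅) * (p : ℝ) ^ (-H) * (p : ℝ) ^ (-1 : ℝ) := by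
          rw [← Real.rpow_add hp0, ← Real.rpow_add hp0, hQ]; congr 1; ring
      _ ≤ lam * rhoMin M X θ₀ (supp θ₀) * (2 * Real.pi * M.Cdev)⁻¹ := by gcongr
      _ = _ := by rw [mul_inv]; ring
  have hsqrt : Q ^ s ≤ Real.sqrt ((lam * (M.Cdev⁻¹ * rhoMin M X θ₀ (supp θ₀)) /
      (2 * Real.pi)) ^ s) := by
    refine Real.le_sqrt_of_sq_le (le_trans ?_ (pow_le_pow_left₀ hQ0.le hbase s))
    rw [pow_two]
    exact mul_le_of_le_one_left (by positivity) (pow_le_one₀ hQ0.le hQ1)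
  have hexp : (p : ℝ) ^ (-(s : ℝ)) ≤ Real.exp (-(lam + α * M.Cdev) / 2) := by
    rw [Real.rpow_def_of_pos hp0]
    refine Real.exp_le_exp.2 ?_
    have h1 : α * M.Cdev ≤ M.Cdev := mul_le_of_le_one_left hCp.le hα
    have h2 : Real.log p * 1 ≤ Real.log p * s :=
      mul_le_mul_of_nonneg_left hs1' (Real.log_nonneg hp)
    linarith
  have hcube : ((p : ℝ) ^ (-(H + 1))) ^ s ≤ (2 * (p : ℝ) ^ (-(H + 1))) ^ s := by
    have : 0 < (p : ℝ) ^ (-(H + 1)) := Real.rpow_pos_of_pos hp0 _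
    exact pow_le_pow_left₀ this.le (by linarith) s
  have hdiv : w s * (p : ℝ) ^ (-(s : ℝ)) ≤ w s / (p.choose s : ℝ) := by
    rw [Real.rpow_neg hp0.le, Real.rpow_natCast, div_eq_mul_inv]
    exact mul_le_mul_of_nonneg_left (inv_anti₀ hch0 hch) (hw s)
  rw [evidenceBound, ← hs]
  calc _ = w s * (p : ℝ) ^ (-(s : ℝ)) * (Q ^ s * (p : ℝ) ^ (-(s : ℝ)) *
        ((p : ℝ) ^ (-(H + 1))) ^ s) := by
        rw [hQ, ← Real.rpow_natCast, ← Real.rpow_natCast, ← Real.rpow_mul hp0.le,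
          ← Real.rpow_mul hp0.le, ← Real.rpow_add hp0, ← Real.rpow_add hp0, mul_assoc,
          ← Real.rpow_add hp0]
        congr 2; ring
    _ ≤ _ := by
        have := hw s
        gcongr

/-- The model size cannot exceed the bound built into the prior. -/
theorem posterior_eq_zero {n p : ℕ} (M : ExpFamily) (X : Matrix (Fin n) (Fin p) ℝ) {w : ℕ → ℝ}
    {smax : ℕ} (hws : ∀ s, smax < s → w s = 0) (lam α : ℝ) {κ : ℝ} (hκ : (smax : ℝ) ≤ κ)
    (y : Fin n → ℝ) : posterior M X w lam α y {θ | κ < ((supp θ).card : ℝ)} = 0 := by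
  rw [posterior, setLIntegral_prior M X w lam α y (measurableSet_card_supp κ),
    Finset.sum_eq_zero, ENNReal.zero_div]
  intro S _
  by_cases hS : smax < S.card
  · simp [hws _ hS]
  · have hempty : extend S ⁻¹' {θ | κ < ((supp θ).card : ℝ)} = ∅ := by
      refine Set.eq_empty_of_forall_notMem fun θ hθ => ?_
      have h1 : (supp (extend S θ)).card ≤ smax :=
        (Finset.card_le_card (supp_extend_subset S θ)).trans (not_lt.1 hS)
      have h2 : ((supp (extend S θ)).card : ℝ) ≤ smax := by exact_mod_cast h1
      exact absurd hθ (not_lt.2 (h2.trans hκ))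
    simp [hempty]

end GLM

/-! ### Asymptotics along the regime -/

/-- Arithmetic of the union bound: with deviations of order `√(log P)` in units of the standard
deviation each coordinate fails with probability `2 P⁻³`, and there are at most `P` of them. -/
theorem GLM.two_mul_exp_le_inv (C : ℝ) {P s : ℝ} (hP : 2 ≤ P) (hs : s ≤ P) (hs0 : 0 ≤ s) :
    2 * s * Real.exp (C / 2 * Real.sqrt (Real.log P) ^ 2 -
      Real.sqrt (Real.log P) * ((C / 2 + 3) * Real.sqrt (Real.log P))) ≤ P⁻¹ := by
  have hP0 : 0 < P := by linarith
  have h1 : C / 2 * Real.sqrt (Real.log P) ^ 2 -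
      Real.sqrt (Real.log P) * ((C / 2 + 3) * Real.sqrt (Real.log P)) = -Real.log (P ^ 3) := by
    rw [Real.log_pow]
    push_cast
    linear_combination -3 * Real.sq_sqrt (Real.log_nonneg (by linarith : 1 ≤ P))
  rw [h1, Real.exp_neg, Real.exp_log (by positivity), ← div_eq_mul_inv,
    div_le_iff₀ (by positivity), show P⁻¹ * P ^ 3 = P * P by field_simp]
  exact mul_le_mul hP hs hs0 hP0.le

namespace Regime

variable {R : Regime}

theorem Standing.S₀_nonempty (hR : R.Standing) {n : ℕ} (hn : R.n₀ ≤ n) : (R.S₀ n).Nonempty := by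
  obtain ⟨j, hj⟩ := Function.ne_iff.1 (hR.theta_ne_zero n hn)
  exact ⟨j, by simpa [S₀, GLM.supp] using hj⟩

theorem Standing.tendsto_p (hR : R.Standing) :
    Tendsto (fun n => (R.p n : ℝ)) atTop atTop := by
  obtain ⟨C, hC, h⟩ := hR.growth
  refine tendsto_atTop_mono' atTop ?_ ((tendsto_rpow_atTop hC).comp tendsto_natCast_atTop_atTop)
  filter_upwards [eventually_ge_atTop R.n₀] with n hn using h n hn

theorem Standing.p_pos (hR : R.Standing) {n : ℕ} (hn : R.n₀ ≤ n) : 0 < R.p n := by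
  obtain ⟨j, -⟩ := hR.S₀_nonempty hn
  exact j.pos

theorem Standing.smax_le (hR : R.Standing) {n : ℕ} (hn : R.n₀ ≤ n) : R.smax n ≤ n :=
  (hR.smax_le_rank n hn).trans (Matrix.rank_le_height _)

/-- The upper ratio bound propagates zeros of `w` upwards, the lower one downwards, so that a
probability mass function satisfying both charges every admissible size. -/
theorem SizePrior.w_pos {A₁ A₂ A₃ A₄ : ℝ} (hR : R.Standing) (hw : R.SizePrior A₁ A₂ A₃ A₄) {n : ℕ}
    (hn : R.n₀ ≤ n) {s : ℕ} (hs : s ≤ R.smax n) : 0 < R.w n s := by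
  have hp : (0 : ℝ) < R.p n := by exact_mod_cast hR.p_pos hn
  have h0 : 0 < R.w n 0 := by
    by_contra! h
    have hz : R.w n 0 = 0 := le_antisymm h (hw.nonneg n hn 0)
    have hall : ∀ s ∈ Finset.range (R.smax n + 1), R.w n s = 0 := fun s hs => by
      have := GLM.weight_decay (c := A₂ * (R.p n : ℝ) ^ (-A₄))
        (mul_nonneg hw.pos₂.le (Real.rpow_nonneg hp.le _)) (hw.upper n hn) 0 s
        (by rw [Finset.mem_range] at hs; omega)
      rw [zero_add, hz, mul_zero] at this
      exact le_antisymm this (hw.nonneg n hn s)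
    have hsum := hw.sum_eq_one n hn
    rw [Finset.sum_eq_zero hall] at hsum
    exact zero_ne_one hsum
  induction s with
  | zero => exact h0
  | succ s ih =>
    have := hw.lower n hn (s + 1) (by omega) hs
    exact (mul_pos (mul_pos hw.pos₁ (Real.rpow_pos_of_pos hp _)) (ih (by omega))).trans_le this

theorem CondA2.lam_pos {M : ExpFamily} {D : ℕ → ℝ} {α A₄ A₅ A₆ A₇ : ℝ} (hR : R.Standing)
    (hA2 : R.CondA2 M D α A₄ A₅ A₆ A₇) {n : ℕ} (hn : R.n₀ ≤ n) : 0 < R.lam n :=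
  (Real.rpow_pos_of_pos (by exact_mod_cast hR.p_pos hn) _).trans_le (hA2.lam_lower n hn)

/-- The condition on the logarithm bounds the norm of the true design and the extreme eigenvalues
of its Fisher information polynomially in `p`. -/
theorem CondA2.exists_poly_bound {M : ExpFamily} {D : ℕ → ℝ} {α A₄ A₅ A₆ A₇ : ℝ}
    (hR : R.Standing) (hA2 : R.CondA2 M D α A₄ A₅ A₆ A₇)
    (hns : ∀ n, R.n₀ ≤ n → IsUnit (GLM.fisherBest M (R.X n) (R.θ₀ n) (R.S₀ n)).det) :
    ∃ H : ℝ, 0 ≤ H ∧ ∀ᶠ n in atTop,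
      GLM.rowSumNorm (GLM.cols (R.X n) (R.S₀ n)) ≤ (R.p n : ℝ) ^ H ∧
      (GLM.rhoMin M (R.X n) (R.θ₀ n) (R.S₀ n))⁻¹ ≤ (R.p n : ℝ) ^ H ∧
      GLM.rhoMax M (R.X n) (R.θ₀ n) (R.S₀ n) ≤ (R.p n : ℝ) ^ H := by
  obtain ⟨c, hc⟩ := hA2.log_bound.bound
  refine ⟨max c 0, le_max_right _ _, ?_⟩
  filter_upwards [hc, eventually_ge_atTop R.n₀, hR.tendsto_p.eventually_ge_atTop 1]
    with n hn hn₀ hp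
  have hρ := GLM.rhoMin_pos M (R.X n) (hR.S₀_nonempty hn₀) (hns n hn₀)
  have hp0 : (0 : ℝ) < R.p n := by linarith
  set m := max (max (max (⨆ i, deriv (deriv M.b) ((R.X n *ᵥ R.θ₀ n) i))
        (GLM.rowSumNorm (GLM.cols (R.X n) (R.S₀ n))))
        (GLM.rhoMin M (R.X n) (R.θ₀ n) (R.S₀ n))⁻¹)
        (GLM.rhoMax M (R.X n) (R.θ₀ n) (R.S₀ n)) with hm
  have hmpos : 0 < m :=
    (inv_pos.2 hρ).trans_le ((le_max_right _ _).trans (le_max_left _ _))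
  have hmle : m ≤ (R.p n : ℝ) ^ max c 0 := by
    rw [← Real.exp_log hmpos, Real.rpow_def_of_pos hp0]
    refine Real.exp_le_exp.2 ?_
    rw [Real.norm_eq_abs, Real.norm_eq_abs, abs_of_nonneg (Real.log_nonneg hp)] at hn
    refine (le_abs_self _).trans (hn.trans ?_)
    rw [mul_comm]
    exact mul_le_mul_of_nonneg_left (le_max_left _ _) (Real.log_nonneg hp)
  refine ⟨le_trans ?_ hmle, le_trans ?_ hmle, le_trans ?_ hmle⟩
  · exact (le_max_right _ _).trans ((le_max_left _ _).trans (le_max_left _ _))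
  · exact (le_max_right _ _).trans (le_max_left _ _)
  · exact le_max_right _ _

/-- The bound for all large `n`, uniformly in the dimension factor beyond a threshold. -/
theorem exists_eventually_lintegral_posterior_le {M : ExpFamily} (hR : R.Standing)
    {A₁ A₂ A₃ A₄ A₅ A₆ A₇ α : ℝ} (hw : R.SizePrior A₁ A₂ A₃ A₄)
    {D : ℕ → ℝ} {θbar : ∀ n, ∀ S : Finset (Fin (R.p n)), S → ℝ}
    (hA1 : R.CondA1 M D θbar) (hA2 : R.CondA2 M D α A₄ A₅ A₆ A₇) :
    ∃ K₁ : ℝ, ∀ᶠ n in atTop, ∀ K : ℝ, K₁ ≤ K →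
      ∫⁻ y, GLM.posterior M (R.X n) (R.w n) (R.lam n) α y
          {θ | K * (R.s₀ n : ℝ) < ((GLM.supp θ).card : ℝ)} ∂(R.P₀ M n) ≤
        ENNReal.ofReal (2 * (R.p n : ℝ)⁻¹ + (R.p n : ℝ) ^ (-(R.s₀ n : ℝ))) := by
  obtain ⟨H, hH, hpoly⟩ := hA2.exists_poly_bound hR hA1.nonsingular_best
  have hA₄ := hw.pos₄
  have hC := M.Cdev_pos
  -- the score is cut at `M₀ √(log p)`, and `ε` makes the product of leverage and score radius
  -- small enough for the localization of the estimator
  set M₀ := M.Cdev / 2 + 3 with hM₀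
  have hM₀pos : 0 < M₀ := by positivity
  set ε := min (1 / 4) ((1 / (8 * M.Cdev * M₀)) ^ 2) with hε
  have hεpos : 0 < ε := by positivity
  -- the prior ratio contributes the exponent `A₄ + 2 - A₄ K / 4` and the evidence
  -- `A₅ + 2 H + 4`, both per unit of `s₀`; beyond the threshold their sum is at most `-1`
  refine ⟨max 1 (4 * (A₄ + 3 + (A₅ + 2 * H + 4)) / A₄), ?_⟩
  have hlogp := Real.tendsto_log_atTop.comp hR.tendsto_p
  filter_upwards [hpoly, eventually_ge_atTop R.n₀, hR.tendsto_p.eventually_ge_atTop 2,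
    hR.tendsto_p.eventually_ge_atTop (2 * Real.pi * M.Cdev),
    hlogp.eventually_ge_atTop ((A₆ + M.Cdev) / 2),
    ((tendsto_rpow_atTop (by positivity : 0 < A₄ / 8)).comp
      hR.tendsto_p).eventually_ge_atTop A₂,
    hA2.logb_D.bound (by positivity : 0 < A₄ / 16), hA1.designReg_small.bound hεpos]
    with n ⟨hrow, hρmin, hρmax⟩ hn hp hpC hlog hA₂p hDn hζ K hK
  simp only [Function.comp_apply] at hlog hA₂p
  set P : ℝ := (R.p n : ℝ) with hP
  have hp0 : 0 < P := by linarith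
  have hp1 : 1 ≤ P := by linarith
  have hlogpos : 0 < Real.log P := Real.log_pos (by linarith)
  have hS₀ : (GLM.supp (R.θ₀ n)).Nonempty := hR.S₀_nonempty hn
  have hs₀ : 1 ≤ R.s₀ n := hS₀.card_pos
  have hs₀' : (1 : ℝ) ≤ R.s₀ n := by exact_mod_cast hs₀
  have hs₀p : (R.s₀ n : ℝ) ≤ P := by
    rw [hP]
    exact_mod_cast (Finset.card_le_univ (R.S₀ n)).trans_eq (Fintype.card_fin _)
  have hlam := hA2.lam_pos hR hn
  have hp₇ : P ^ (-A₇) ≤ 1 :=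
    Real.rpow_le_one_of_one_le_of_nonpos hp1 (neg_nonpos.2 hA2.nonneg₇)
  have hlam₆ : R.lam n ≤ A₆ := (hA2.lam_upper n hn).trans (mul_le_of_le_one_right hA2.pos₆.le hp₇)
  have hlam₄ : R.lam n ≤ A₄ := (hA2.lam_upper n hn).trans (hA2.lt_A₄ n hn).le
  have hD2 := (hA1.sqrt_two_lt n hn).le
  have hDpos : 0 < D n := (Real.sqrt_pos.2 two_pos).trans_le hD2
  have hDp : D n ≤ P ^ (A₄ / 16) := by
    rw [← Real.logb_le_iff_le_rpow (by linarith) hDpos]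
    simpa using (le_abs_self _).trans hDn
  have hws : ∀ s, R.w n s ≠ 0 → s ≤ R.smax n := fun s hs => by
    by_contra! h
    exact hs (hw.eq_zero n hn s h)
  have hw₀ := hw.w_pos hR hn (hR.s₀_le_smax n hn)
  -- leverage and score radius
  set ζ := GLM.designReg M (R.X n) (R.θ₀ n) (GLM.supp (R.θ₀ n)) with hζdef
  have hζ0 : 0 ≤ ζ := GLM.designReg_nonneg _ _ _ _
  have hq : ζ ^ 2 * R.s₀ n * Real.log P ≤ ε := by
    rw [norm_one, mul_one] at hζ
    exact (le_abs_self _).trans hζ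
  set t := Real.sqrt (Real.log P) with ht
  have ht0 : 0 < t := Real.sqrt_pos.2 hlogpos
  have ht2 : t ^ 2 = Real.log P := Real.sq_sqrt hlogpos.le
  have hprod : ζ * (Real.sqrt (R.s₀ n) * t) ≤ Real.sqrt ε := by
    refine Real.le_sqrt_of_sq_le ?_
    rw [mul_pow, mul_pow, Real.sq_sqrt (Nat.cast_nonneg _), ht2, ← mul_assoc]
    exact hq
  have hlev : t * ζ ≤ 1 / 2 := by
    have h1 : t * ζ ≤ ζ * (Real.sqrt (R.s₀ n) * t) := by
      have h2 : 1 ≤ Real.sqrt (R.s₀ n) := Real.one_le_sqrt.2 hs₀'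
      rw [mul_comm t ζ]
      exact mul_le_mul_of_nonneg_left (le_mul_of_one_le_left ht0.le h2) hζ0
    refine h1.trans (hprod.trans ?_)
    rw [Real.sqrt_le_left (by norm_num)]
    exact (min_le_left _ _).trans (by norm_num)
  have hsmall : 2 * M.Cdev * ζ * (Real.sqrt (R.s₀ n) * (M₀ * t)) < 1 / 2 := by
    have h1 : Real.sqrt ε ≤ 1 / (8 * M.Cdev * M₀) := by
      rw [Real.sqrt_le_left (by positivity)]
      exact min_le_right _ _
    calc _ = 2 * M.Cdev * M₀ * (ζ * (Real.sqrt (R.s₀ n) * t)) := by ring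
      _ ≤ 2 * M.Cdev * M₀ * (1 / (8 * M.Cdev * M₀)) := by
          gcongr; exact hprod.trans h1
      _ = 1 / 4 := by field_simp; norm_num
      _ < 1 / 2 := by norm_num
  -- size of the cube
  set r := P ^ (-(H + 1)) with hr
  have hr0 : 0 < r := Real.rpow_pos_of_pos hp0 _
  have hPr : P ^ H * r = P⁻¹ := by
    rw [hr, ← Real.rpow_add hp0, ← Real.rpow_neg_one]; congr 1; ring
  have hrow' : GLM.rowSumNorm (GLM.cols (R.X n) (GLM.supp (R.θ₀ n))) * r ≤ 1 / 2 := by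
    refine (mul_le_mul_of_nonneg_right hrow hr0.le).trans ?_
    rw [hPr, one_div]
    exact inv_anti₀ two_pos hp
  have hup : M.Cdev * (GLM.rhoMax M (R.X n) (R.θ₀ n) (GLM.supp (R.θ₀ n)) *
      ((GLM.supp (R.θ₀ n)).card * r ^ 2)) ≤ 1 := by
    have hCP : M.Cdev ≤ P :=
      (le_mul_of_one_le_left hC.le (by linarith [Real.pi_gt_three])).trans hpC
    have hr1 : r ≤ P⁻¹ := by
      rw [hr, ← Real.rpow_neg_one]
      exact Real.rpow_le_rpow_of_exponent_le hp1 (by linarith)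
    have hsr : (R.s₀ n : ℝ) * r ≤ 1 := by
      calc (R.s₀ n : ℝ) * r ≤ P * P⁻¹ := by gcongr
        _ = 1 := mul_inv_cancel₀ hp0.ne'
    calc _ ≤ P * (P ^ H * ((R.s₀ n : ℝ) * r ^ 2)) := by
          refine mul_le_mul hCP (mul_le_mul_of_nonneg_right hρmax (by positivity)) ?_ hp0.le
          have : 0 ≤ GLM.rhoMax M (R.X n) (R.θ₀ n) (GLM.supp (R.θ₀ n)) :=
            Real.iSup_nonneg fun j => (GLM.fisher_posSemidef M _ _).eigenvalues_nonneg j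
          positivity
      _ = (R.s₀ n : ℝ) * r * (P * (P ^ H * r)) := by ring
      _ = (R.s₀ n : ℝ) * r := by rw [hPr, mul_inv_cancel₀ hp0.ne', mul_one]
      _ ≤ 1 := hsr
  have main := GLM.lintegral_posterior_le M (R.X n) hS₀ (hA1.nonsingular_best n hn)
    (hw.nonneg n hn) hw₀ (κ := K * R.s₀ n) hlam hA2.alpha_pos.le hA2.alpha_lt_one.le hDpos ht0
    (τ := M₀ * t) (by positivity) hr0 (θbar := θbar n)
    (fun S hS => hA1.nonsingular_bar n hn S (hws _ hS)) (hA1.mle_close n hn)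
    (fun y hy S hS => hy S (hws _ hS)) hlev hsmall hrow' hup
  refine main.trans ?_
  have htail := GLM.two_mul_exp_le_inv M.Cdev hp hs₀p (Nat.cast_nonneg _)
  have hratio : (∑ S : Finset (Fin (R.p n)), GLM.inflatedWeight (R.w n) (R.lam n) (D n)
      (K * R.s₀ n) S) / GLM.evidenceBound M (R.X n) (R.θ₀ n) (R.w n) (R.lam n) α r ≤
      P ^ (-(R.s₀ n : ℝ)) := by
    have hnum := GLM.sum_inflatedWeight_le hp (hw.nonneg n hn) hs₀ hw.pos₂ hA₄ (hw.eq_zero n hn)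
      (hw.upper n hn) hA₂p hlam₄ hD2 hDp ((le_max_left _ _).trans hK)
    have hden := GLM.le_evidenceBound M (R.X n) hp1 hS₀ (hA1.nonsingular_best n hn)
      (hw.nonneg n hn) hH hA2.pos₅ hA2.alpha_lt_one.le (hA2.lam_lower n hn) hlam₆ hlog hpC hρmin
    have hden0 : 0 < R.w n (R.s₀ n) * P ^ (-(A₅ + 2 * H + 4) * R.s₀ n) :=
      mul_pos hw₀ (Real.rpow_pos_of_pos hp0 _)
    rw [div_le_iff₀ (hden0.trans_le hden)]
    refine hnum.trans (le_trans ?_ (mul_le_mul_of_nonneg_left hden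
      (Real.rpow_nonneg hp0.le _)))
    change _ ≤ P ^ (-(R.s₀ n : ℝ)) * (R.w n (R.s₀ n) * P ^ (-(A₅ + 2 * H + 4) * (R.s₀ n : ℝ)))
    rw [mul_left_comm, ← Real.rpow_add hp0]
    refine mul_le_mul_of_nonneg_left (Real.rpow_le_rpow_of_exponent_le hp1 ?_) hw₀.le
    have hK' := (le_max_right _ _).trans hK
    rw [div_le_iff₀ hA₄] at hK'
    have : A₄ + 2 - A₄ / 4 * K ≤ -(1 + (A₅ + 2 * H + 4)) := by linarith
    have := mul_le_mul_of_nonneg_right this (Nat.cast_nonneg (R.s₀ n) : (0 : ℝ) ≤ _)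
    linarith
  have hPinv : 0 ≤ P⁻¹ := (inv_pos.2 hp0).le
  rw [two_mul P⁻¹, ENNReal.ofReal_add (by positivity) (by positivity),
    ENNReal.ofReal_add hPinv hPinv]
  exact add_le_add (add_le_add le_rfl (ENNReal.ofReal_le_ofReal htail))
    (ENNReal.ofReal_le_ofReal hratio)

end Regime

theorem theorem3p1 (M : ExpFamily) (R : Regime) (hR : R.Standing)
    (A₁ A₂ A₃ A₄ A₅ A₆ A₇ α : ℝ) (hw : R.SizePrior A₁ A₂ A₃ A₄)
    (D : ℕ → ℝ) (θbar : ∀ n, ∀ S : Finset (Fin (R.p n)), S → ℝ)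
    (hA1 : R.CondA1 M D θbar) (hA2 : R.CondA2 M D α A₄ A₅ A₆ A₇) :
    ∃ Kdim : ℝ, 1 < Kdim ∧ ∀ n, R.n₀ ≤ n →
      AEMeasurable (fun y => GLM.posterior M (R.X n) (R.w n) (R.lam n) α y
        {θ | Kdim * (R.s₀ n : ℝ) < ((GLM.supp θ).card : ℝ)}) (R.P₀ M n) ∧
      ∫⁻ y, GLM.posterior M (R.X n) (R.w n) (R.lam n) α y
          {θ | Kdim * (R.s₀ n : ℝ) < ((GLM.supp θ).card : ℝ)} ∂(R.P₀ M n) ≤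
        ENNReal.ofReal (((R.s₀ n : ℝ) * Real.log (R.p n))⁻¹ + 2 * (R.p n : ℝ)⁻¹ +
          (R.p n : ℝ) ^ (-(R.s₀ n : ℝ))) := by
  obtain ⟨K₁, hK₁⟩ := Regime.exists_eventually_lintegral_posterior_le hR hw hA1 hA2
  obtain ⟨N, hN⟩ := eventually_atTop.1 hK₁
  refine ⟨max K₁ (N + 2), lt_of_lt_of_le (by norm_cast; omega) (le_max_right _ _),
    fun n hn => ⟨?_, ?_⟩⟩
  · refine (GLM.measurable_posterior M (R.X n) (hA2.lam_pos hR hn) α (fun S hS => ?_)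
      (GLM.measurableSet_card_supp _)).aemeasurable
    refine GLM.injective_mulVec_of_fisher M (hA1.nonsingular_bar n hn S ?_)
    by_contra! h
    exact hS (hw.eq_zero n hn _ h)
  rcases le_or_gt N n with hNn | hNn
  · refine (hN n hNn _ (le_max_left _ _)).trans (ENNReal.ofReal_le_ofReal ?_)
    have hlog : 0 ≤ Real.log (R.p n) :=
      Real.log_nonneg (by exact_mod_cast hR.p_pos hn)
    have : 0 ≤ ((R.s₀ n : ℝ) * Real.log (R.p n))⁻¹ := by positivity
    linarith
  · -- the finitely many small sample sizes: the prior does not charge the event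
    have hs₀ : (1 : ℝ) ≤ R.s₀ n := by exact_mod_cast (hR.S₀_nonempty hn).card_pos
    have hκ : (R.smax n : ℝ) ≤ max K₁ (N + 2) * R.s₀ n := by
      have h1 : (R.smax n : ℝ) ≤ N := by exact_mod_cast (hR.smax_le hn).trans hNn.le
      have h2 : (N : ℝ) + 2 ≤ max K₁ (N + 2) := le_max_right _ _
      have h3 : (0 : ℝ) ≤ N := Nat.cast_nonneg N
      nlinarith
    simp_rw [GLM.posterior_eq_zero M (R.X n) (hw.eq_zero n hn) (R.lam n) α hκ]
    simp
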